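/- A category $\mathcal E$ is \emph{countably lextensive} if it has finite limits and countable coproducts, and every countable coproduct in $\mathcal E$ is a van Kampen colimit (i.e. is universal and effective). Let $\mathcal E$ be a countably lextensive category (not assumed to be locally cartesian closed), and let $s\mathcal E = [\Delta^{\mathrm{op}}, \mathcal E]$ be its category of simplicial objects. For $E \in \mathcal E$ and $X \in s\mathcal E$ put $(E \times X)_n = E \times X_n$, and for $X, Y \in s\mathcal E$ let $\underline{\mathrm{Hom}}(X,Y)$ be the presheaf $E \mapsto \mathrm{Hom}_{s\mathcal E}(E \times X, Y)$ on $\mathcal E$. A map $i \colon A \to B$ has the \emph{enriched left lifting property} with respect to $p \colon X \to Y$ (and $p$ has the \emph{enriched right lifting property} with respect to $i$) if the induced map of presheaves $$\underline{\mathrm{Hom}}(B,X) \longrightarrow \underline{\mathrm{Hom}}(A,X) \times_{\underline{\mathrm{Hom}}(A,Y)} \underline{\mathrm{Hom}}(B,Y)$$ is a split epimorphism. For a levelwise countable simplicial set $K$ let $\underline{K} \in s\mathcal E$ be given by $\underline{K}_n = \coprod_{K_n} 1$. A map of $s\mathcal E$ is a \emph{trivial fibration} if it has the enriched right lifting property with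 respect to $\underline{\partial\Delta[n]} \to \underline{\Delta[n]}$ for all $n \geq 0$, and a \emph{cofibration} if it has the enriched left lifting property with respect to all trivial fibrations. An object $X$ of $s\mathcal E$ is \emph{cofibrant} if $\varnothing \to X$ is a cofibration. \textbf{Theorem.} Let $i \colon A \to B$ be a cofibration between cofibrant objects of $s\mathcal E$. Then: \begin{enumerate} \item[(i)] $i$ is exponentiable, i.e. the pullback functor $i^* \colon s\mathcal E \downarrow B \to s\mathcal E \downarrow A$ has a right adjoint $i_*$ (the pushforward along $i$); \item[(ii)] $i_*$ sends cofibrant objects to cofibrant objects: if $X \to A$ is an object of $s\mathcal E \downarrow A$ with $X$ cofibrant in $s\mathcal E$, then the domain of $i_*(X \to A)$ is cofibrant in $s\mathcal E$. \end{enumerate} -/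

import Mathlib

open CategoryTheory CategoryTheory.Limits Opposite
open scoped Simplicial

universe w w' v u

/-- A category is countably lextensive if it has finite limits and countable coproducts, and every
countable coproduct is a van Kampen colimit (i.e. universal and effective). -/
class CountablyLextensive (E : Type u) [Category.{v} E] : Prop where
  hasFiniteLimits : HasFiniteLimits E
  hasCountableCoproducts : HasCountableCoproducts E
  vanKampen : ∀ {J : Type} [Countable J] (F : Discrete J ⥤ E) (c : Cocone F),
    IsColimit c → IsVanKampenColimit c

attribute [instance] CountablyLextensive.hasFiniteLimits
attribute [instance] CountablyLextensive.hasCountableCoproducts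

namespace EnrichedLifting

noncomputable section

section Diagram

variable {E : Type u} [Category.{v} E] [HasFiniteLimits E] {D : Type w} [Category.{w'} D]

/-- The tensor `e × X` of a diagram `X : D ⥤ E` with an object `e` of `E`:
`(e × X)_d = e × X_d`. -/
def tensor (e : E) (X : D ⥤ E) : D ⥤ E :=
  X ⋙ prod.functor.obj e

/-- Functoriality of `e × X` in `X`. -/
def tensorMapRight (e : E) {X X' : D ⥤ E} (f : X ⟶ X') : tensor e X ⟶ tensor e X' :=
  Functor.whiskerRight f (prod.functor.obj e)

/-- Functoriality of `e × X` in `e`. -/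
def tensorMapLeft {e e' : E} (t : e ⟶ e') (X : D ⥤ E) : tensor e X ⟶ tensor e' X :=
  Functor.whiskerLeft X (prod.functor.map t)

lemma tensorMapLeft_id (e : E) (X : D ⥤ E) : tensorMapLeft (𝟙 e) X = 𝟙 (tensor e X) := by
  ext d
  simp [tensorMapLeft, tensor]

lemma tensorMapLeft_comp {e e' e'' : E} (t : e ⟶ e') (t' : e' ⟶ e'') (X : D ⥤ E) :
    tensorMapLeft (t ≫ t') X = tensorMapLeft t X ≫ tensorMapLeft t' X := by
  ext d
  simp [tensorMapLeft, tensor]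

lemma tensorMap_comm {e e' : E} (t : e ⟶ e') {X X' : D ⥤ E} (f : X ⟶ X') :
    tensorMapLeft t X ≫ tensorMapRight e' f = tensorMapRight e f ≫ tensorMapLeft t X' := by
  ext d
  exact ((prod.functor.map t).naturality (f.app d)).symm

/-- The hom-presheaf of the enrichment of `D ⥤ E` in presheaves over `E`: it sends `e` to the set
of maps `e × X ⟶ Y`. -/
def homPresheaf (X Y : D ⥤ E) : Eᵒᵖ ⥤ Type (max w v) where
  obj e := tensor e.unop X ⟶ Y
  map t := ↾fun h => tensorMapLeft t.unop X ≫ h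
  map_id e := by
    refine ConcreteCategory.hom_ext _ _ fun h => ?_
    simp [tensorMapLeft_id]
  map_comp t t' := by
    refine ConcreteCategory.hom_ext _ _ fun h => ?_
    simp [tensorMapLeft_comp]

/-- The presheaf of lifting problems of `i : A ⟶ B` against `p : X ⟶ Y`, i.e. the pullback
`Hom(A, X) ×_{Hom(A, Y)} Hom(B, Y)` of hom-presheaves, computed objectwise. -/
def probPresheaf {A B X Y : D ⥤ E} (i : A ⟶ B) (p : X ⟶ Y) : Eᵒᵖ ⥤ Type (max w v) where
  obj e := { ab : (tensor e.unop A ⟶ X) × (tensor e.unop B ⟶ Y) //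
    ab.1 ≫ p = tensorMapRight e.unop i ≫ ab.2 }
  map t := ↾fun ab => ⟨(tensorMapLeft t.unop A ≫ ab.1.1, tensorMapLeft t.unop B ≫ ab.1.2), by
    rw [Category.assoc, ab.2, ← Category.assoc, tensorMap_comm, Category.assoc]⟩
  map_id e := by
    refine ConcreteCategory.hom_ext _ _ fun h => ?_
    simp [tensorMapLeft_id]
  map_comp t t' := by
    refine ConcreteCategory.hom_ext _ _ fun h => ?_
    simp [tensorMapLeft_comp]

/-- The pullback hom `Hom(B, X) ⟶ Prob(i, p)` of `i : A ⟶ B` and `p : X ⟶ Y`. -/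
def pullbackHom {A B X Y : D ⥤ E} (i : A ⟶ B) (p : X ⟶ Y) :
    homPresheaf B X ⟶ probPresheaf i p where
  app e := ↾fun h => ⟨(tensorMapRight e.unop i ≫ h, h ≫ p), Category.assoc _ _ _⟩
  naturality e e' t := by
    refine ConcreteCategory.hom_ext _ _ fun h => ?_
    refine Subtype.ext (Prod.ext ?_ ?_)
    · have key : ∀ g : tensor e.unop B ⟶ X,
          tensorMapRight e'.unop i ≫ tensorMapLeft t.unop B ≫ g =
            tensorMapLeft t.unop A ≫ tensorMapRight e.unop i ≫ g := fun g => by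
        rw [← Category.assoc, ← tensorMap_comm, Category.assoc]
      exact key h
    · exact Category.assoc _ _ _

/-- `i` has the enriched left lifting property with respect to `p` (equivalently, `p` has the
enriched right lifting property with respect to `i`): the pullback hom is a split epimorphism of
presheaves over `E`. -/
def HasEnrichedLift {A B X Y : D ⥤ E} (i : A ⟶ B) (p : X ⟶ Y) : Prop :=
  IsSplitEpi (pullbackHom i p)

/-- The enriched `I`-fibrations: maps with the enriched right lifting property with respect to
all maps in `I`. -/
def enrichedFibrations (I : MorphismProperty (D ⥤ E)) : MorphismProperty (D ⥤ E) :=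
  fun _ _ p => ∀ ⦃A B : D ⥤ E⦄ (i : A ⟶ B), I i → HasEnrichedLift i p

/-- The enriched `I`-cofibrations: maps with the enriched left lifting property with respect to
all enriched `I`-fibrations. -/
def enrichedCofibrations (I : MorphismProperty (D ⥤ E)) : MorphismProperty (D ⥤ E) :=
  fun _ _ i => ∀ ⦃X Y : D ⥤ E⦄ (p : X ⟶ Y), enrichedFibrations I p → HasEnrichedLift i p

end Diagram

section Simplicial

variable {E : Type u} [Category.{v} E]

instance (n : ℕ) (m : SimplexCategoryᵒᵖ) : Countable ((Δ[n] : SSet.{0}).obj m) :=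
  (SSet.stdSimplex.objEquiv (n := ⦋n⦌) (m := m)).injective.countable

instance (n : ℕ) (m : SimplexCategoryᵒᵖ) : Countable ((∂Δ[n] : SSet.{0}).obj m) :=
  inferInstanceAs (Countable (∂Δ[n].obj m))

variable [HasFiniteLimits E] [HasCountableCoproducts E]

variable (E) in
/-- The levelwise application of `S ↦ S · 1 = ∐_{s ∈ S} 1` to a levelwise countable
simplicial set. -/
def fset (K : SSet.{0}) [∀ m, Countable (K.obj m)] : SimplicialObject E where
  obj m := ∐ fun _ : K.obj m => ⊤_ E
  map {m _} f := Sigma.desc fun s : K.obj m => Sigma.ι (fun _ => ⊤_ E) (K.map f s)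
  map_id m := by
    apply Sigma.hom_ext
    simp
  map_comp f g := by
    apply Sigma.hom_ext
    simp

variable (E) in
/-- Functoriality of `fset`. -/
def fsetMap {K L : SSet.{0}} [∀ m, Countable (K.obj m)] [∀ m, Countable (L.obj m)] (k : K ⟶ L) :
    fset E K ⟶ fset E L where
  app m := Sigma.desc fun s : K.obj m => Sigma.ι (fun _ => ⊤_ E) (k.app m s)
  naturality m m' f := by
    apply Sigma.hom_ext
    intro s
    simp [fset]

variable (E) in
/-- The generating cofibrations of simplicial objects in `E`: the images under `fset` of the
boundary inclusions `∂Δ[n] ⟶ Δ[n]` for `n ≥ 0`. -/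
def boundaryInclusions : MorphismProperty (SimplicialObject E) :=
  MorphismProperty.ofHoms fun n : ℕ => fsetMap E (∂Δ[n] : (Δ[n] : SSet.{0}).Subcomplex).ι

/-- A map of simplicial objects is a cofibration if it is an enriched cofibration with respect to
the boundary inclusions. -/
def Cofibration {A B : SimplicialObject E} (i : A ⟶ B) : Prop :=
  enrichedCofibrations (boundaryInclusions E) i

instance : HasInitial (SimplicialObject E) :=
  inferInstanceAs (HasInitial (SimplexCategoryᵒᵖ ⥤ E))

/-- A simplicial object is cofibrant if the map from the initial object is a cofibration. -/
def Cofibrant (X : SimplicialObject E) : Prop :=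
  Cofibration (initial.to X)

/-- Simplicial objects have pullbacks. -/
instance : HasPullbacks (SimplicialObject E) :=
  inferInstanceAs (HasPullbacks (SimplexCategoryᵒᵖ ⥤ E))

end Simplicial

/-- A map `f : X ⟶ Y` is exponentiable if the pullback functor `f^* : C/Y ⥤ C/X` has a right
adjoint. -/
def Exponentiable {C : Type u} [Category.{v} C] [HasPullbacks C] {X Y : C} (f : X ⟶ Y) : Prop :=
  (Over.pullback f).IsLeftAdjoint

end

end EnrichedLifting

/-!
For an idempotent operator `e`, let `fixedSieve X e` be the sieve of those generalized simplices of
`X` which `e` fixes. If `X` is cofibrant these sieves are decidable, as one sees by lifting against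
classifiers of lifts, which are trivial fibrations. Conversely, if degeneracy of simplices is
decidable in `X`, then filling the nondegenerate simplices canonically singles out a unique lift
against any trivial fibration; by uniqueness such lifts glue along coproduct decompositions, so that
`X` is cofibrant. Moreover, a cofibration is levelwise the inclusion of a coproduct summand.

If `f : U ⟶ V` is a coproduct inclusion with complement `U'`, then the partial lifts of elements of
`V` along some `W ⟶ U`, defined where the element lies in `U`, are classified by `W ⨿ U'`. An
`n`-simplex of the pushforward along a cofibration is a compatible family of partial lifts over the
simplices of `Δ[n]`. Such a family is determined by its values in dimensions at most `n`, so that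
the pushforward is cut out by finite limits. An idempotent operator fixes a member of the
pushforward if and only if it fixes the underlying simplex of `B` as well as the partial lifts over
all faces which it stabilizes. This is a finite conjunction of decidable conditions, so the
pushforward is cofibrant.
-/

namespace EnrichedLifting

noncomputable section

section Extensive

variable {E : Type u} [Category.{v} E]

instance [CountablyLextensive E] : FinitaryExtensive E where
  hasFiniteCoproducts := inferInstance
  hasPullbacksOfInclusions := inferInstance
  van_kampen' _ hc := CountablyLextensive.vanKampen _ _ hc

/-- The negation of a sieve `S`: the morphisms which meet `S` only over initial objects. -/
def negSieve {V : E} (S : Sieve V) : Sieve V where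
  arrows T t := ∀ ⦃T' : E⦄ (u : T' ⟶ T), S (u ≫ t) → Nonempty (IsInitial T')
  downward_closed h u _ u' hu := h (u' ≫ u) (by rwa [Category.assoc])

lemma negSieve_pullback {V V' : E} (S : Sieve V) (f : V' ⟶ V) :
    negSieve (S.pullback f) = (negSieve S).pullback f := by
  ext T t
  simp [negSieve, Sieve.pullback]

lemma nonempty_isInitial_of_negSieve {V T : E} {S : Sieve V} {t : T ⟶ V} (h : S t)
    (h' : negSieve S t) : Nonempty (IsInitial T) :=
  h' (𝟙 T) (by rwa [Category.id_comp])

/-- The sieve of the morphisms which factor through `f`. -/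
abbrev factorSieve {U V : E} (f : U ⟶ V) : Sieve V :=
  Sieve.generate (Presieve.singleton f)

lemma factorSieve_apply {U V T : E} (f : U ⟶ V) (t : T ⟶ V) :
    factorSieve f t ↔ ∃ t' : T ⟶ U, t' ≫ f = t := by
  constructor
  · rintro ⟨_, t', _, ⟨⟩, ht'⟩
    exact ⟨t', ht'⟩
  · rintro ⟨t', ht'⟩
    exact ⟨_, t', _, Presieve.singleton_self f, ht'⟩

/-- A coproduct inclusion: a morphism which is the first inclusion of a binary coproduct. -/
def IsCoproductInclusion {U V : E} (f : U ⟶ V) : Prop :=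
  ∃ (U' : E) (f' : U' ⟶ V), Nonempty (IsColimit (BinaryCofan.mk f f'))

section Covers

variable [FinitaryPreExtensive E]

lemma nonempty_isInitial_of_hom {T T' : E} (h : Nonempty (IsInitial T)) (u : T' ⟶ T) :
    Nonempty (IsInitial T') :=
  have := h.some.isIso_to u
  ⟨h.some.ofIso (asIso u).symm⟩

/-- The relation `R` encodes a problem which is stable under restriction: the solutions of it over
the members of a cover glue, because they are unique. -/
lemma existsUnique_of_cover {V W : E} {S : Sieve V} (hS : S ∈ extensiveTopology E V)
    (R : ∀ ⦃T : E⦄, (T ⟶ V) → (T ⟶ W) → Prop)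
    (hR : ∀ ⦃T T' : E⦄ (u : T' ⟶ T) (t : T ⟶ V) (w : T ⟶ W), R t w → R (u ≫ t) (u ≫ w))
    (hex : ∀ ⦃T : E⦄ (t : T ⟶ V), S t → ∃! w : T ⟶ W, R t w) :
    ∃! w : V ⟶ W, ∀ ⦃T : E⦄ (t : T ⟶ V), S t → R t (t ≫ w) := by
  choose f hf hfu using hex
  let x : Presieve.FamilyOfElements (yoneda.obj W) S.arrows := f
  have hx : x.Compatible := (Presieve.compatible_iff_sieveCompatible x).2 fun T T' t u ht =>
    (hfu (u ≫ t) (S.downward_closed ht u) (u ≫ f t ht) (hR u t _ (hf t ht))).symm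
  obtain ⟨w, hw : ∀ _ t ht, t ≫ w = f t ht, hwu⟩ :=
    extensiveTopology.isSheaf_yoneda_obj W S hS x hx
  exact ⟨w, fun T t ht => by rw [hw]; exact hf t ht,
    fun w' hw' => hwu w' fun T t ht => hfu t ht _ (hw' t ht)⟩

lemma hom_ext_of_cover {V W : E} {S : Sieve V} (hS : S ∈ extensiveTopology E V) {f g : V ⟶ W}
    (h : ∀ ⦃T : E⦄ (t : T ⟶ V), S t → t ≫ f = t ≫ g) : f = g :=
  (extensiveTopology.isSheaf_yoneda_obj W S hS).isSeparatedFor.ext fun _ t ht => h t ht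

lemma sup_factorSieve_mem_extensiveTopology {U U' V : E} {f : U ⟶ V} {f' : U' ⟶ V}
    (h : IsColimit (BinaryCofan.mk f f')) :
    factorSieve f ⊔ factorSieve f' ∈ extensiveTopology E V := by
  rw [extensiveTopology.mem_sieves_iff_contains_colimit_cofan]
  refine ⟨WalkingPair, inferInstance, fun j => WalkingPair.casesOn j U U',
    fun j => by cases j; exacts [f, f'], ⟨?_⟩, ?_⟩
  · refine Cofan.IsColimit.mk _ (fun s => BinaryCofan.IsColimit.desc' h
      (s.inj .left) (s.inj .right) |>.1) ?_ ?_
    · rintro s (_ | _)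
      · exact (BinaryCofan.IsColimit.desc' h (s.inj .left) (s.inj .right)).2.1
      · exact (BinaryCofan.IsColimit.desc' h (s.inj .left) (s.inj .right)).2.2
    · intro s m hm
      apply BinaryCofan.IsColimit.hom_ext h
      · exact (hm .left).trans
          (BinaryCofan.IsColimit.desc' h (s.inj .left) (s.inj .right)).2.1.symm
      · exact (hm .right).trans
          (BinaryCofan.IsColimit.desc' h (s.inj .left) (s.inj .right)).2.2.symm
  · rintro (_ | _)
    · exact Or.inl ((factorSieve_apply _ _).2 ⟨𝟙 _, Category.id_comp _⟩)
    · exact Or.inr ((factorSieve_apply _ _).2 ⟨𝟙 _, Category.id_comp _⟩)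

/-- A sieve is decidable if, locally for the extensive topology, every morphism lies in it or in
its negation. -/
def IsDecidable {V : E} (S : Sieve V) : Prop :=
  S ⊔ negSieve S ∈ extensiveTopology E V

namespace IsDecidable

variable {V : E} {S K : Sieve V}

lemma pullback {V' : E} (h : IsDecidable S) (f : V' ⟶ V) : IsDecidable (S.pullback f) := by
  refine GrothendieckTopology.superset_covering _ ?_ ((extensiveTopology E).pullback_stable f h)
  rintro T t (ht | ht)
  · exact Or.inl ht
  · exact Or.inr (by rwa [negSieve_pullback])

lemma of_cover {R : Sieve V} (hR : R ∈ extensiveTopology E V)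
    (h : ∀ ⦃T : E⦄ (t : T ⟶ V), R t → IsDecidable (S.pullback t)) : IsDecidable S := by
  refine (extensiveTopology E).transitive hR _ fun T t ht =>
    GrothendieckTopology.superset_covering _ ?_ (h t ht)
  rintro T' u (hu | hu)
  · exact Or.inl hu
  · exact Or.inr (by rwa [negSieve_pullback] at hu)

lemma of_id_mem (h : S (𝟙 V)) : IsDecidable S :=
  GrothendieckTopology.superset_covering _ le_sup_left
    (by rw [(Sieve.id_mem_iff_eq_top).1 h]; exact (extensiveTopology E).top_mem _)

lemma of_id_mem_neg (h : negSieve S (𝟙 V)) : IsDecidable S :=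
  GrothendieckTopology.superset_covering _ le_sup_right
    (by rw [(Sieve.id_mem_iff_eq_top).1 h]; exact (extensiveTopology E).top_mem _)

/-- The second condition only has to be decided where the first one holds. -/
lemma inf_of (hS : IsDecidable S)
    (hK : ∀ ⦃T : E⦄ (t : T ⟶ V), S t → IsDecidable (K.pullback t)) : IsDecidable (S ⊓ K) := by
  refine of_cover hS ?_
  rintro T t (ht | ht)
  · rw [Sieve.pullback_inter, (Sieve.mem_iff_pullback_eq_top t).1 ht, top_inf_eq]
    exact hK t ht
  · exact of_id_mem_neg fun T' u hu => ht u (by simpa using hu.1)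

lemma inf (hS : IsDecidable S) (hK : IsDecidable K) : IsDecidable (S ⊓ K) :=
  hS.inf_of fun _ t _ => hK.pullback t

lemma sup (hS : IsDecidable S) (hK : IsDecidable K) : IsDecidable (S ⊔ K) := by
  refine of_cover hS ?_
  rintro T t (ht | ht)
  · exact of_id_mem (Or.inl (by simpa using ht))
  · refine of_cover (hK.pullback t) fun T' u hu => ?_
    rcases hu with hu | hu
    · exact of_id_mem (Or.inr (by simpa using hu))
    · refine of_id_mem_neg fun T'' r hr => ?_
      rw [negSieve_pullback] at hu
      rcases hr with hr | hr
      · exact ht (r ≫ u) (by simpa using hr)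
      · exact hu r (by simpa using hr)

lemma iSup {ι : Type*} [Finite ι] {S : ι → Sieve V} (h : ∀ j, IsDecidable (S j)) :
    IsDecidable (⨆ j, S j) := by
  cases nonempty_fintype ι
  rw [← Finset.sup_univ_eq_iSup]
  exact Finset.sup_induction (of_id_mem_neg fun _ _ h => h.elim) (fun _ hS _ hK => hS.sup hK)
    fun j _ => h j

lemma iInf {ι : Sort*} [Finite ι] {S : ι → Sieve V} (h : ∀ j, IsDecidable (S j)) :
    IsDecidable (⨅ j, S j) := by
  cases nonempty_fintype (PLift ι)
  rw [← iInf_plift_down, ← Finset.inf_univ_eq_iInf]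
  exact Finset.inf_induction (of_id_mem trivial) (fun _ hS _ hK => hS.inf hK) fun j _ => h j.down

end IsDecidable

end Covers

section Disjoint

variable [FinitaryExtensive E]

lemma IsCoproductInclusion.mono {U V : E} {f : U ⟶ V} (hf : IsCoproductInclusion f) : Mono f :=
  have ⟨_, _, ⟨h⟩⟩ := hf
  FinitaryExtensive.mono_inl_of_isColimit h

lemma nonempty_isInitial_of_isColimit {U U' V T : E} {f : U ⟶ V} {f' : U' ⟶ V}
    (h : IsColimit (BinaryCofan.mk f f')) (t : T ⟶ U) (t' : T ⟶ U') (htt' : t ≫ f = t' ≫ f') :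
    Nonempty (IsInitial T) :=
  nonempty_isInitial_of_hom ⟨initialIsInitial⟩
    ((FinitaryExtensive.isPullback_initial_to_binaryCofan h).lift t t' htt')

lemma isColimit_iff_isPullback {U U' V T K K' : E} {f : U ⟶ V} {f' : U' ⟶ V}
    (h : IsColimit (BinaryCofan.mk f f')) {t : T ⟶ V} {fst : K ⟶ T} {fst' : K' ⟶ T} {snd : K ⟶ U}
    {snd' : K' ⟶ U'} (w : fst ≫ t = snd ≫ f) (w' : fst' ≫ t = snd' ≫ f') :
    Nonempty (IsColimit (BinaryCofan.mk fst fst')) ↔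
      IsPullback fst snd t f ∧ IsPullback fst' snd' t f' := by
  refine ((FinitaryExtensive.vanKampen _ h) (BinaryCofan.mk fst fst') (mapPair snd snd') t
    (by ext (_ | _); exacts [w.symm, w'.symm]) (NatTrans.Equifibered.of_discrete _)).trans
    ⟨fun hp => ⟨hp ⟨.left⟩, hp ⟨.right⟩⟩, ?_⟩
  rintro ⟨hl, hr⟩ ⟨_ | _⟩
  exacts [hl, hr]

lemma IsCoproductInclusion.isDecidable_factorSieve {U V : E} {f : U ⟶ V}
    (hf : IsCoproductInclusion f) : IsDecidable (factorSieve f) := by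
  obtain ⟨U', f', ⟨h⟩⟩ := hf
  refine GrothendieckTopology.superset_covering _ (sup_le_sup le_rfl ?_)
    (sup_factorSieve_mem_extensiveTopology h)
  intro T t ht T' u hu
  obtain ⟨t', rfl⟩ := (factorSieve_apply _ _).1 ht
  obtain ⟨u', hu'⟩ := (factorSieve_apply _ _).1 hu
  exact nonempty_isInitial_of_isColimit h u' (u ≫ t') (by simpa using hu')

/-- The complement is the preimage of the second summand under `h : V ⟶ U ⨿ V`. -/
lemma isCoproductInclusion_of_lift [HasPullbacks E] {U V : E} (f : U ⟶ V) (h : V ⟶ U ⨿ V)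
    (hf : f ≫ h = coprod.inl) (hh : h ≫ coprod.desc f (𝟙 V) = 𝟙 V) : IsCoproductInclusion f := by
  refine ⟨pullback h coprod.inr, pullback.fst _ _, ?_⟩
  have hP : IsPullback f (𝟙 U) h coprod.inl := by
    refine ⟨⟨by simp [hf]⟩, ⟨PullbackCone.IsLimit.mk _ (fun s => s.snd) (fun s => ?_)
      (fun s => by simp) fun s m _ hm => by simpa using hm⟩⟩
    have := s.condition =≫ coprod.desc f (𝟙 V)
    rw [Category.assoc, Category.assoc, coprod.inl_desc, hh, Category.comp_id] at this
    exact this.symm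
  exact (isColimit_iff_isPullback (coprodIsCoprod U V) hP.w pullback.condition).2
    ⟨hP, .of_hasPullback _ _⟩

end Disjoint

end Extensive

section Lifts

variable {E : Type u} [Category.{v} E] [HasFiniteLimits E] {D : Type w} [Category.{w'} D]

section

variable {A B X Y : D ⥤ E} {i : A ⟶ B} {p : X ⟶ Y}

/-- Unique choices are natural: it suffices to single out one lift of each problem by a condition
which is stable under change of parameters. -/
lemma hasEnrichedLift_of_existsUnique (Good : ∀ ⦃e : E⦄, (tensor e B ⟶ X) → Prop)
    (hGood : ∀ ⦃e e' : E⦄ (t : e' ⟶ e) (l : tensor e B ⟶ X), Good l → Good (tensorMapLeft t B ≫ l))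
    (hex : ∀ (e : E) (a : tensor e A ⟶ X) (b : tensor e B ⟶ Y), a ≫ p = tensorMapRight e i ≫ b →
      ∃! l : tensor e B ⟶ X, tensorMapRight e i ≫ l = a ∧ l ≫ p = b ∧ Good l) :
    HasEnrichedLift i p := by
  choose l hl hlu using hex
  let sec : probPresheaf i p ⟶ homPresheaf B X :=
    { app := fun e => ↾fun x => l e.unop x.1.1 x.1.2 x.2
      naturality := fun e e' t => by
        refine ConcreteCategory.hom_ext _ _ fun x => ?_
        obtain ⟨hi, hp, hg⟩ := hl e.unop x.1.1 x.1.2 x.2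
        refine (hlu e'.unop _ _ _ _ ⟨?_, ?_, hGood t.unop _ hg⟩).symm
        · rw [← Category.assoc, ← tensorMap_comm, Category.assoc, hi]
          rfl
        · rw [Category.assoc, hp]
          rfl }
  refine ⟨⟨⟨sec, ?_⟩⟩⟩
  ext e x
  have h := hl e.unop x.1.1 x.1.2 x.2
  exact Subtype.ext (Prod.ext h.1 h.2.1)

namespace HasEnrichedLift

variable (h : HasEnrichedLift i p)
include h

/-- The lifts provided by a natural section of the pullback hom. -/
def lift {e : E} (a : tensor e A ⟶ X) (b : tensor e B ⟶ Y) (hab : a ≫ p = tensorMapRight e i ≫ b) :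
    tensor e B ⟶ X :=
  (Classical.choice h.exists_splitEpi).section_.app (op e) ⟨(a, b), hab⟩

variable {e : E} {a : tensor e A ⟶ X} {b : tensor e B ⟶ Y} (hab : a ≫ p = tensorMapRight e i ≫ b)

lemma map_lift : tensorMapRight e i ≫ h.lift a b hab = a :=
  congrArg (fun x => x.1.1) (ConcreteCategory.congr_hom (NatTrans.congr_app
    (Classical.choice h.exists_splitEpi).id (op e)) ⟨(a, b), hab⟩)

lemma lift_comp : h.lift a b hab ≫ p = b :=
  congrArg (fun x => x.1.2) (ConcreteCategory.congr_hom (NatTrans.congr_app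
    (Classical.choice h.exists_splitEpi).id (op e)) ⟨(a, b), hab⟩)

lemma lift_naturality {e' : E} (t : e' ⟶ e) :
    tensorMapLeft t B ≫ h.lift a b hab =
      h.lift (tensorMapLeft t A ≫ a) (tensorMapLeft t B ≫ b)
        (by rw [Category.assoc, hab, ← Category.assoc, tensorMap_comm, Category.assoc]) :=
  (ConcreteCategory.congr_hom
    ((Classical.choice h.exists_splitEpi).section_.naturality t.op) ⟨(a, b), hab⟩).symm

end HasEnrichedLift

end

/-- The projection `e × X ⟶ X`. -/
def tensorSnd (e : E) (X : D ⥤ E) : tensor e X ⟶ X where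
  app d := (prod.snd : e ⨯ X.obj d ⟶ X.obj d)
  naturality _ _ f := prod.map_snd (𝟙 e) (X.map f)

/-- The isomorphism `X ⟶ 1 × X`. -/
def tensorUnit (X : D ⥤ E) : X ⟶ tensor (⊤_ E) X where
  app d := prod.lift (terminal.from (X.obj d)) (𝟙 _)
  naturality d d' f := by
    change X.map f ≫ prod.lift _ _ = prod.lift _ _ ≫ prod.map (𝟙 _) (X.map f)
    apply Limits.prod.hom_ext
    · exact Subsingleton.elim (α := _ ⟶ ⊤_ E) _ _
    · simp

lemma tensorUnit_tensorSnd (X : D ⥤ E) : tensorUnit X ≫ tensorSnd _ X = 𝟙 X := by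
  ext d
  exact prod.lift_snd _ _

lemma tensorMapRight_tensorSnd (e : E) {X Y : D ⥤ E} (f : X ⟶ Y) :
    tensorMapRight e f ≫ tensorSnd e Y = tensorSnd e X ≫ f := by
  ext d
  exact prod.map_snd (𝟙 e) (f.app d)

lemma tensorMapLeft_tensorSnd {e e' : E} (t : e' ⟶ e) (X : D ⥤ E) :
    tensorMapLeft t X ≫ tensorSnd e X = tensorSnd e' X := by
  ext d
  exact (prod.map_snd t (𝟙 (X.obj d))).trans (Category.comp_id _)

lemma tensorUnit_naturality {X Y : D ⥤ E} (f : X ⟶ Y) :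
    tensorUnit X ≫ tensorMapRight _ f = f ≫ tensorUnit Y := by
  ext d
  change prod.lift _ _ ≫ prod.map (𝟙 _) (f.app d) = f.app d ≫ prod.lift _ _
  apply Limits.prod.hom_ext
  · exact Subsingleton.elim (α := _ ⟶ ⊤_ E) _ _
  · simp

lemma HasEnrichedLift.hasLiftingProperty {A B X Y : D ⥤ E} {i : A ⟶ B} {p : X ⟶ Y}
    (h : HasEnrichedLift i p) : HasLiftingProperty i p where
  sq_hasLift {a b} sq := by
    have hab : (tensorSnd (⊤_ E) A ≫ a) ≫ p = tensorMapRight _ i ≫ tensorSnd (⊤_ E) B ≫ b := by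
      rw [Category.assoc, sq.w, ← Category.assoc (tensorMapRight _ _), tensorMapRight_tensorSnd,
        Category.assoc]
    refine ⟨⟨⟨tensorUnit B ≫ h.lift _ _ hab, ?_, ?_⟩⟩⟩
    · rw [← Category.assoc, ← tensorUnit_naturality, Category.assoc, h.map_lift, ← Category.assoc,
        tensorUnit_tensorSnd, Category.id_comp]
    · rw [Category.assoc, h.lift_comp, ← Category.assoc, tensorUnit_tensorSnd, Category.id_comp]

end Lifts

section Points

variable {E : Type u} [Category.{v} E] [HasFiniteLimits E] [HasCountableCoproducts E]

/-- The inclusion of `T` into `T × ∐_S 1` at an element of `S`. -/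
def copowerPoint (T : E) {S : Type} [Countable S] (s : S) : T ⟶ T ⨯ ∐ fun _ : S => ⊤_ E :=
  prod.lift (𝟙 T) (terminal.from T ≫ Sigma.ι (fun _ : S => ⊤_ E) s)

lemma copowerPoint_map (T : E) {S S' : Type} [Countable S] [Countable S'] (s : S) (f : S → S') :
    copowerPoint T s ≫ prod.map (𝟙 T) (Sigma.desc fun s => Sigma.ι (fun _ : S' => ⊤_ E) (f s)) =
      copowerPoint T (f s) := by
  ext <;> simp [copowerPoint]

lemma copowerPoint_map_left {T T' : E} (t : T' ⟶ T) {S : Type} [Countable S] (s : S) :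
    copowerPoint T' s ≫ prod.map t (𝟙 (∐ fun _ : S => ⊤_ E)) = t ≫ copowerPoint T s := by
  ext <;> simp [copowerPoint, ← Category.assoc]

lemma copowerPoint_fst (T : E) {S : Type} [Countable S] (s : S) :
    copowerPoint T s ≫ prod.fst = 𝟙 T :=
  prod.lift_fst _ _

lemma copowerPoint_snd (T : E) {S : Type} [Countable S] (s : S) :
    copowerPoint T s ≫ prod.snd = terminal.from T ≫ Sigma.ι (fun _ : S => ⊤_ E) s :=
  prod.lift_snd _ _

lemma isPullback_copowerPoint (T : E) {S : Type} [Countable S] (s : S) :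
    IsPullback (copowerPoint T s) (terminal.from T) prod.snd (Sigma.ι (fun _ : S => ⊤_ E) s) := by
  refine ⟨⟨copowerPoint_snd T s⟩, ⟨PullbackCone.IsLimit.mk _ (fun c => c.fst ≫ prod.fst)
    (fun c => Limits.prod.hom_ext ?_ ?_) (fun c => Subsingleton.elim _ _) fun c f hf _ => ?_⟩⟩
  · rw [Category.assoc, copowerPoint_fst, Category.comp_id]
  · rw [Category.assoc, copowerPoint_snd, c.condition, ← Category.assoc]
    congr 1
    exact Subsingleton.elim _ _
  · rw [← hf, Category.assoc, copowerPoint_fst, Category.comp_id]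

/-- The simplex of `e × K` at a simplex `s` of `K`. -/
def simplexPoint {K : SSet.{0}} [∀ m, Countable (K.obj m)] (T : E) {m : SimplexCategoryᵒᵖ}
    (s : K.obj m) : T ⟶ (tensor T (fset E K)).obj m :=
  copowerPoint T s

section

variable {K L : SSet.{0}} [∀ m, Countable (K.obj m)] [∀ m, Countable (L.obj m)]

lemma simplexPoint_map (T : E) {m m' : SimplexCategoryᵒᵖ} (s : K.obj m) (f : m ⟶ m') :
    simplexPoint T s ≫ (tensor T (fset E K)).map f = simplexPoint T (K.map f s) :=
  copowerPoint_map T s (K.map f)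

lemma simplexPoint_tensorMapRight (T : E) {m : SimplexCategoryᵒᵖ} (s : K.obj m) (k : K ⟶ L) :
    simplexPoint T s ≫ (tensorMapRight T (fsetMap E k)).app m = simplexPoint T (k.app m s) :=
  copowerPoint_map T s (k.app m)

lemma simplexPoint_tensorMapLeft {T T' : E} (t : T' ⟶ T) {m : SimplexCategoryᵒᵖ} (s : K.obj m) :
    simplexPoint T' s ≫ (tensorMapLeft t (fset E K)).app m = t ≫ simplexPoint T s :=
  copowerPoint_map_left t s

end

section Finite

variable [FinitaryPreExtensive E]

lemma nonempty_isColimit_copowerPoint (T : E) (S : Type) [Finite S] :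
    Nonempty (IsColimit (Cofan.mk _ fun s : S => copowerPoint T s)) := by
  refine FinitaryPreExtensive.isUniversal_finiteCoproducts
    (coproductIsCoproduct fun _ : S => ⊤_ E) (Cofan.mk _ fun s : S => copowerPoint T s)
    (Discrete.natTrans fun _ => terminal.from T) prod.snd ?_ (NatTrans.Equifibered.of_discrete _) ?_
  · ext ⟨s⟩
    exact (prod.lift_snd _ _).symm
  · rintro ⟨s⟩
    exact isPullback_copowerPoint T s

variable {K : SSet.{0}} [∀ m, Finite (K.obj m)]

lemma tensor_fset_obj_hom_ext {T W : E} {m : SimplexCategoryᵒᵖ}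
    {f g : (tensor T (fset E K)).obj m ⟶ W}
    (h : ∀ s : K.obj m, simplexPoint T s ≫ f = simplexPoint T s ≫ g) : f = g :=
  Cofan.IsColimit.hom_ext (nonempty_isColimit_copowerPoint T (K.obj m)).some _ _ h

lemma tensor_fset_hom_ext {T : E} {P : SimplicialObject E} {f g : tensor T (fset E K) ⟶ P}
    (h : ∀ (m) (s : K.obj m), simplexPoint T s ≫ f.app m = simplexPoint T s ≫ g.app m) : f = g := by
  ext m
  exact tensor_fset_obj_hom_ext (h m)

/-- The morphism out of `T × ∐_{K_m} 1` with given components. -/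
def tensorDesc {T W : E} {m : SimplexCategoryᵒᵖ} (φ : K.obj m → (T ⟶ W)) :
    (tensor T (fset E K)).obj m ⟶ W :=
  Cofan.IsColimit.desc (nonempty_isColimit_copowerPoint T (K.obj m)).some φ

lemma simplexPoint_tensorDesc {T W : E} {m : SimplexCategoryᵒᵖ} (φ : K.obj m → (T ⟶ W))
    (s : K.obj m) : simplexPoint T s ≫ tensorDesc φ = φ s :=
  Cofan.IsColimit.fac (nonempty_isColimit_copowerPoint T (K.obj m)).some φ s

/-- The morphism out of `T × K` given by a natural family of morphisms indexed by the simplices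
of `K`. -/
def simplicialDesc {T : E} {P : SimplicialObject E} (φ : ∀ m, K.obj m → (T ⟶ P.obj m))
    (hφ : ∀ ⦃m m'⦄ (f : m ⟶ m') (s : K.obj m), φ m s ≫ P.map f = φ m' (K.map f s)) :
    tensor T (fset E K) ⟶ P where
  app m := tensorDesc (φ m)
  naturality m m' f := by
    apply tensor_fset_obj_hom_ext
    intro s
    rw [← Category.assoc, simplexPoint_map, simplexPoint_tensorDesc, ← Category.assoc,
      simplexPoint_tensorDesc, hφ]

lemma simplexPoint_simplicialDesc {T : E} {P : SimplicialObject E}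
    (φ : ∀ m, K.obj m → (T ⟶ P.obj m)) (hφ) {m : SimplexCategoryᵒᵖ} (s : K.obj m) :
    simplexPoint T s ≫ (simplicialDesc φ hφ).app m = φ m s :=
  simplexPoint_tensorDesc _ _

end Finite

end Points

section Coinduced

variable {E : Type u} [Category.{v} E] [HasFiniteLimits E]

instance (a b : SimplexCategoryᵒᵖ) : Finite (a ⟶ b) :=
  Finite.of_equiv (b.unop ⟶ a.unop) (opEquiv a b).symm

/-- The simplicial object cofreely generated by an object of `E` in a given degree. -/
def coinduced (n : SimplexCategoryᵒᵖ) (Z : E) : SimplicialObject E :=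
  (evaluationRightAdjoint E n).obj Z

/-- The evaluation of a coinduced simplicial object at its cogenerator. -/
def coinducedCounit (n : SimplexCategoryᵒᵖ) (Z : E) : (coinduced n Z).obj n ⟶ Z :=
  (evaluationAdjunctionLeft E n).counit.app Z

variable {n : SimplexCategoryᵒᵖ} {Z : E} {V : SimplicialObject E}

/-- The morphism into a coinduced simplicial object determined by a morphism in one degree. -/
def coinducedLift (f : V.obj n ⟶ Z) : V ⟶ coinduced n Z :=
  (evaluationAdjunctionLeft E n).homEquiv V Z f

lemma coinducedLift_counit (f : V.obj n ⟶ Z) :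
    (coinducedLift f).app n ≫ coinducedCounit n Z = f :=
  ((evaluationAdjunctionLeft E n).homEquiv_counit _ _ _).symm.trans
    (((evaluationAdjunctionLeft E n).homEquiv V Z).symm_apply_apply f)

lemma comp_coinducedLift_counit {V' : SimplicialObject E} (a : V' ⟶ V) (f : V.obj n ⟶ Z) :
    (a ≫ coinducedLift f).app n ≫ coinducedCounit n Z = a.app n ≫ f := by
  rw [NatTrans.comp_app, Category.assoc, coinducedLift_counit]

lemma coinduced_hom_ext {f g : V ⟶ coinduced n Z}
    (h : f.app n ≫ coinducedCounit n Z = g.app n ≫ coinducedCounit n Z) : f = g :=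
  ((evaluationAdjunctionLeft E n).homEquiv V Z).symm.injective
    (((evaluationAdjunctionLeft E n).homEquiv_counit _ _ _).trans
      (h.trans ((evaluationAdjunctionLeft E n).homEquiv_counit _ _ _).symm))

/-- A simplicial object over `X` which classifies the lifts along `π` of the `n`-simplices of `X`
whose restrictions along an operator `s` are prescribed: its simplices are the simplices `x` of
`X` together with a lift `h` of each `n`-simplex obtained from `x` by a simplicial operator, such
that `h ≫ ζ = k y` for the `n`-simplices of the form `y · s`. -/
structure LiftClassifier (X : SimplicialObject E) {m n : SimplexCategoryᵒᵖ} (s : m ⟶ n) {Z Z' : E}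
    (π : Z ⟶ X.obj n) (ζ : Z ⟶ Z') (k : X.obj m ⟶ Z') where
  /-- The classifying simplicial object. -/
  obj : SimplicialObject E
  /-- The projection to `X`. -/
  proj : obj ⟶ X
  /-- The universal lift. -/
  point : obj.obj n ⟶ Z
  point_comp : point ≫ π = proj.app n
  map_point : obj.map s ≫ point ≫ ζ = proj.app m ≫ k
  /-- The morphism classifying a lift. -/
  lift {V : SimplicialObject E} (a : V ⟶ X) (h : V.obj n ⟶ Z) (hπ : h ≫ π = a.app n)
    (hζ : V.map s ≫ h ≫ ζ = a.app m ≫ k) : V ⟶ obj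
  lift_proj {V : SimplicialObject E} (a : V ⟶ X) (h : V.obj n ⟶ Z) (hπ hζ) :
    lift a h hπ hζ ≫ proj = a
  lift_point {V : SimplicialObject E} (a : V ⟶ X) (h : V.obj n ⟶ Z) (hπ hζ) :
    (lift a h hπ hζ).app n ≫ point = h
  hom_ext {V : SimplicialObject E} {l l' : V ⟶ obj} (hproj : l ≫ proj = l' ≫ proj)
    (hpoint : l.app n ≫ point = l'.app n ≫ point) : l = l'

section

variable (X : SimplicialObject E) {Z : E} (π : Z ⟶ X.obj n)

/-- The simplicial object over `X` classifying unconditional lifts along `π`. -/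
abbrev freeClassifier : SimplicialObject E :=
  pullback (coinducedLift (𝟙 (X.obj n))) (coinducedLift (coinducedCounit n Z ≫ π))

/-- The universal unconditional lift. -/
def freePoint : (freeClassifier X π).obj n ⟶ Z :=
  (pullback.snd _ _ : freeClassifier X π ⟶ _).app n ≫ coinducedCounit n Z

variable {X π}

lemma freePoint_comp :
    freePoint X π ≫ π = (pullback.fst _ _ : freeClassifier X π ⟶ _).app n := by
  have h := congrArg (fun f => f.app n ≫ coinducedCounit n (X.obj n))
    (pullback.condition (f := coinducedLift (𝟙 (X.obj n)))
      (g := coinducedLift (coinducedCounit n Z ≫ π)))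
  simp only [comp_coinducedLift_counit, Category.comp_id] at h
  rw [h, freePoint, Category.assoc]

lemma coinducedLift_condition {a : V ⟶ X} {h : V.obj n ⟶ Z} (hπ : h ≫ π = a.app n) :
    a ≫ coinducedLift (𝟙 (X.obj n)) =
      coinducedLift h ≫ coinducedLift (coinducedCounit n Z ≫ π) := by
  apply coinduced_hom_ext
  rw [comp_coinducedLift_counit, comp_coinducedLift_counit, ← Category.assoc, coinducedLift_counit,
    hπ, Category.comp_id]

lemma lift_freePoint {a : V ⟶ X} {h : V.obj n ⟶ Z} (hπ : h ≫ π = a.app n) :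
    (pullback.lift a (coinducedLift h) (coinducedLift_condition hπ)).app n ≫ freePoint X π = h := by
  rw [freePoint, ← Category.assoc, ← NatTrans.comp_app, pullback.lift_snd, coinducedLift_counit]

lemma freeClassifier_hom_ext {l l' : V ⟶ freeClassifier X π}
    (hfst : l ≫ pullback.fst _ _ = l' ≫ pullback.fst _ _)
    (hpoint : l.app n ≫ freePoint X π = l'.app n ≫ freePoint X π) : l = l' :=
  pullback.hom_ext hfst (coinduced_hom_ext (by simpa [freePoint] using hpoint))

end

/-- The classifier of lifts is cut out of the unconditional one by an equalizer. -/
def liftClassifier (X : SimplicialObject E) {m n : SimplexCategoryᵒᵖ} (s : m ⟶ n) {Z Z' : E}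
    (π : Z ⟶ X.obj n) (ζ : Z ⟶ Z') (k : X.obj m ⟶ Z') : LiftClassifier X s π ζ k :=
  let f : freeClassifier X π ⟶ coinduced m Z' :=
    coinducedLift ((freeClassifier X π).map s ≫ freePoint X π ≫ ζ)
  let g : freeClassifier X π ⟶ coinduced m Z' :=
    coinducedLift ((pullback.fst _ _ : freeClassifier X π ⟶ X).app m ≫ k)
  { obj := equalizer f g
    proj := equalizer.ι f g ≫ pullback.fst _ _
    point := (equalizer.ι f g).app n ≫ freePoint X π
    point_comp := by rw [Category.assoc, freePoint_comp]; rfl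
    map_point := by
      have h := congrArg (fun l => l.app m ≫ coinducedCounit m Z') (equalizer.condition f g)
      simp only [f, g, comp_coinducedLift_counit] at h
      rw [Category.assoc, ← Category.assoc, (equalizer.ι f g).naturality, Category.assoc]
      exact h.trans (Category.assoc _ _ _).symm
    lift a h hπ hζ := equalizer.lift (pullback.lift a _ (coinducedLift_condition hπ)) <| by
      apply coinduced_hom_ext
      rw [comp_coinducedLift_counit, comp_coinducedLift_counit, ← Category.assoc,
        ← NatTrans.naturality, Category.assoc, ← Category.assoc _ (freePoint X π),
        lift_freePoint hπ, hζ, ← Category.assoc, ← NatTrans.comp_app, pullback.lift_fst]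
    lift_proj a h hπ hζ := by rw [← Category.assoc, equalizer.lift_ι, pullback.lift_fst]
    lift_point a h hπ hζ := by
      rw [← Category.assoc, ← NatTrans.comp_app, equalizer.lift_ι, lift_freePoint hπ]
    hom_ext hproj hpoint := equalizer.hom_ext (freeClassifier_hom_ext
      (by simpa only [Category.assoc] using hproj)
      (by simpa only [NatTrans.comp_app, Category.assoc] using hpoint)) }

end Coinduced

section TestFibrations

variable {E : Type u} [Category.{v} E]

section

variable {X : SimplicialObject E} {m n : SimplexCategoryᵒᵖ} {s : m ⟶ n} {Z Z' : E}
  {π : Z ⟶ X.obj n} {ζ : Z ⟶ Z'} {k : X.obj m ⟶ Z'}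

/-- The data showing that the lifts classified by a `LiftClassifier` exist: sections of `π` over
all `n`-simplices and over those of the form `y · s`, the latter of which satisfy the condition. -/
structure CanonicalLifts (s : m ⟶ n) (π : Z ⟶ X.obj n) (ζ : Z ⟶ Z') (k : X.obj m ⟶ Z') where
  /-- The operator `s` is split. -/
  retraction : n ⟶ m
  comp_retraction : s ≫ retraction = 𝟙 m
  /-- The lifts of arbitrary `n`-simplices. -/
  sec : X.obj n ⟶ Z
  sec_comp : sec ≫ π = 𝟙 _
  /-- The lifts of the `n`-simplices `y · s`. -/
  mapSec : X.obj m ⟶ Z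
  mapSec_comp : mapSec ≫ π = X.map s
  mapSec_cond : mapSec ≫ ζ = k

namespace CanonicalLifts

variable (c : CanonicalLifts s π ζ k) {K : SSet.{0}}

include c in
lemma map_injective : Function.Injective (K.map s) := by
  intro τ τ' h
  have := congrArg (K.map c.retraction) h
  rwa [← Functor.map_comp_apply, ← Functor.map_comp_apply, c.comp_retraction, Functor.map_id_apply,
    Functor.map_id_apply] at this

include c in
lemma mem_of_map_mem (S : K.Subcomplex) {τ : K.obj m} (h : K.map s τ ∈ S.obj n) : τ ∈ S.obj m := by
  have := S.map c.retraction h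
  rwa [Set.mem_preimage, ← Functor.map_comp_apply, c.comp_retraction, Functor.map_id_apply] at this

variable [HasFiniteLimits E] [HasCountableCoproducts E] [∀ m, Countable (K.obj m)] {T : E}

open Classical in
/-- The canonical lift of the `n`-simplex of `X` at a simplex of `K`. -/
def value (b : tensor T (fset E K) ⟶ X) (τ : K.obj n) : T ⟶ Z :=
  if h : ∃ τ' : K.obj m, K.map s τ' = τ then simplexPoint T h.choose ≫ b.app m ≫ c.mapSec
  else simplexPoint T τ ≫ b.app n ≫ c.sec

lemma value_map (b : tensor T (fset E K) ⟶ X) (τ : K.obj m) :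
    c.value b (K.map s τ) = simplexPoint T τ ≫ b.app m ≫ c.mapSec := by
  have h : ∃ τ' : K.obj m, K.map s τ' = K.map s τ := ⟨τ, rfl⟩
  rw [value, dif_pos h, c.map_injective h.choose_spec]

lemma value_comp (b : tensor T (fset E K) ⟶ X) (τ : K.obj n) :
    c.value b τ ≫ π = simplexPoint T τ ≫ b.app n := by
  by_cases h : ∃ τ' : K.obj m, K.map s τ' = τ
  · obtain ⟨τ', rfl⟩ := h
    rw [value_map, Category.assoc, Category.assoc, mapSec_comp, ← b.naturality, ← Category.assoc,
      simplexPoint_map]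
  · rw [value, dif_neg h, Category.assoc, Category.assoc, sec_comp, Category.comp_id]

lemma value_tensorMapLeft (b : tensor T (fset E K) ⟶ X) (τ : K.obj n) {T' : E} (t : T' ⟶ T) :
    c.value (tensorMapLeft t _ ≫ b) τ = t ≫ c.value b τ := by
  by_cases h : ∃ τ' : K.obj m, K.map s τ' = τ <;>
    simp only [value, dif_pos, dif_neg, h, NatTrans.comp_app, ← Category.assoc,
      not_false_eq_true, simplexPoint_tensorMapLeft]

end CanonicalLifts

namespace LiftClassifier

variable [HasFiniteLimits E] [HasCountableCoproducts E] (P : LiftClassifier X s π ζ k)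
  {K : SSet.{0}} [∀ m, Finite (K.obj m)] {T : E}

/-- The lift at an `n`-simplex of `K` which is classified by a morphism `T × K ⟶ P`. -/
def value (l : tensor T (fset E K) ⟶ P.obj) (τ : K.obj n) : T ⟶ Z :=
  simplexPoint T τ ≫ l.app n ≫ P.point

lemma value_comp (l : tensor T (fset E K) ⟶ P.obj) (τ : K.obj n) :
    P.value l τ ≫ π = simplexPoint T τ ≫ (l ≫ P.proj).app n := by
  rw [value, Category.assoc, Category.assoc, P.point_comp, NatTrans.comp_app]

lemma value_map (l : tensor T (fset E K) ⟶ P.obj) (τ : K.obj m) :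
    P.value l (K.map s τ) ≫ ζ = simplexPoint T τ ≫ (l ≫ P.proj).app m ≫ k := by
  rw [value, ← simplexPoint_map, Category.assoc, Category.assoc, Category.assoc,
    ← Category.assoc (CategoryTheory.Functor.map _ s), l.naturality, Category.assoc, P.map_point,
    NatTrans.comp_app, Category.assoc]

lemma value_tensorMapLeft (l : tensor T (fset E K) ⟶ P.obj) (τ : K.obj n) {T' : E} (t : T' ⟶ T) :
    P.value (tensorMapLeft t _ ≫ l) τ = t ≫ P.value l τ := by
  simp only [value, NatTrans.comp_app, ← Category.assoc, simplexPoint_tensorMapLeft]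

lemma value_tensorMapRight {L : SSet.{0}} [∀ m, Finite (L.obj m)] (j : L ⟶ K)
    (l : tensor T (fset E K) ⟶ P.obj) (τ : L.obj n) :
    P.value (tensorMapRight T (fsetMap E j) ≫ l) τ = P.value l (j.app n τ) := by
  simp only [value, NatTrans.comp_app, ← Category.assoc, simplexPoint_tensorMapRight]

variable [FinitaryPreExtensive E]

lemma tensor_hom_ext {l l' : tensor T (fset E K) ⟶ P.obj} (hproj : l ≫ P.proj = l' ≫ P.proj)
    (hvalue : ∀ τ, P.value l τ = P.value l' τ) : l = l' :=
  P.hom_ext hproj (tensor_fset_obj_hom_ext hvalue)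

lemma exists_tensor_lift (b : tensor T (fset E K) ⟶ X) (ψ : K.obj n → (T ⟶ Z))
    (hπ : ∀ τ, ψ τ ≫ π = simplexPoint T τ ≫ b.app n)
    (hζ : ∀ τ, ψ (K.map s τ) ≫ ζ = simplexPoint T τ ≫ b.app m ≫ k) :
    ∃ l : tensor T (fset E K) ⟶ P.obj, l ≫ P.proj = b ∧ ∀ τ, P.value l τ = ψ τ := by
  refine ⟨P.lift b (tensorDesc ψ) (tensor_fset_obj_hom_ext fun τ => ?_)
    (tensor_fset_obj_hom_ext fun τ => ?_), P.lift_proj _ _ _ _, fun τ => ?_⟩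
  · rw [← Category.assoc, simplexPoint_tensorDesc, hπ]
  · rw [← Category.assoc, simplexPoint_map, ← Category.assoc, simplexPoint_tensorDesc, hζ]
  · rw [value, P.lift_point, simplexPoint_tensorDesc]

/-- The lift is prescribed on `S`; elsewhere the canonical lifts are used. -/
lemma hasEnrichedLift (c : CanonicalLifts s π ζ k) (S : K.Subcomplex)
    [∀ m, Finite ((S : SSet.{0}).obj m)] : HasEnrichedLift (fsetMap E S.ι) P.proj := by
  classical
  refine hasEnrichedLift_of_existsUnique
    (fun T l => ∀ τ ∉ S.obj n, P.value l τ = c.value (l ≫ P.proj) τ)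
    (fun T T' t l hl τ hτ => ?_) fun T a b hab => ?_
  · rw [P.value_tensorMapLeft, hl τ hτ, Category.assoc, c.value_tensorMapLeft]
  have hab' (j) (τ : (S : SSet.{0}).obj j) :
      simplexPoint T τ ≫ (a ≫ P.proj).app j = simplexPoint T τ.1 ≫ b.app j := by
    rw [hab, NatTrans.comp_app, ← Category.assoc, simplexPoint_tensorMapRight]
    rfl
  let ψ (τ : K.obj n) : T ⟶ Z := if h : τ ∈ S.obj n then P.value a ⟨τ, h⟩ else c.value b τ
  have hψ_mem (τ : (S : SSet.{0}).obj n) : ψ τ.1 = P.value a τ := dif_pos τ.2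
  have hψ_not {τ : K.obj n} (h : τ ∉ S.obj n) : ψ τ = c.value b τ := dif_neg h
  have hπ (τ) : ψ τ ≫ π = simplexPoint T τ ≫ b.app n := by
    by_cases h : τ ∈ S.obj n
    · exact (congrArg (· ≫ π) (hψ_mem ⟨τ, h⟩)).trans ((P.value_comp a _).trans (hab' n ⟨τ, h⟩))
    · rw [hψ_not h, c.value_comp]
  have hζ (τ) : ψ (K.map s τ) ≫ ζ = simplexPoint T τ ≫ b.app m ≫ k := by
    by_cases h : K.map s τ ∈ S.obj n
    · let τ' : (S : SSet.{0}).obj m := ⟨τ, c.mem_of_map_mem S h⟩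
      rw [← Category.assoc, ← hab' m τ', Category.assoc, ← P.value_map a τ', ← hψ_mem]
      rfl
    · rw [hψ_not h, c.value_map, Category.assoc, Category.assoc, c.mapSec_cond]
  obtain ⟨l, hlb, hl⟩ := P.exists_tensor_lift b ψ hπ hζ
  refine ⟨l, ⟨P.tensor_hom_ext (by rw [Category.assoc, hlb, hab]) fun τ => ?_, hlb,
    fun τ hτ => by rw [hl, hlb, hψ_not hτ]⟩, ?_⟩
  · rw [value_tensorMapRight, hl]
    exact hψ_mem τ
  · rintro l' ⟨rfl, hl'b, hl'⟩
    refine P.tensor_hom_ext (by rw [hlb, hl'b]) fun τ => ?_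
    rw [hl]
    by_cases h : τ ∈ S.obj n
    · exact ((hψ_mem ⟨τ, h⟩).trans (P.value_tensorMapRight S.ι l' ⟨τ, h⟩)).symm
    · rw [hl' τ h, hl'b, hψ_not h]

end LiftClassifier

end

instance (n : ℕ) (m : SimplexCategoryᵒᵖ) : Finite ((Δ[n] : SSet.{0}).obj m) :=
  Finite.of_equiv _ (SSet.stdSimplex.objEquiv (n := ⦋n⦌) (m := m)).symm

instance (n : ℕ) (m : SimplexCategoryᵒᵖ) : Finite ((∂Δ[n] : SSet.{0}).obj m) :=
  inferInstanceAs (Finite (∂Δ[n].obj m))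

variable [HasFiniteLimits E] [HasCountableCoproducts E]

lemma Cofibration.exists_lift [FinitaryPreExtensive E] {A B : SimplicialObject E} {i : A ⟶ B}
    (hi : Cofibration i) {m n : SimplexCategoryᵒᵖ} {s : m ⟶ n} {Z Z' : E} {π : Z ⟶ B.obj n}
    {ζ : Z ⟶ Z'} {k : B.obj m ⟶ Z'} (c : CanonicalLifts s π ζ k) (h₀ : A.obj n ⟶ Z)
    (hπ : h₀ ≫ π = i.app n) (hζ : A.map s ≫ h₀ ≫ ζ = i.app m ≫ k) :
    ∃ h : B.obj n ⟶ Z, i.app n ≫ h = h₀ ∧ h ≫ π = 𝟙 _ ∧ B.map s ≫ h ≫ ζ = k := by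
  let P := liftClassifier B s π ζ k
  have hp : enrichedFibrations (boundaryInclusions E) P.proj := by
    rintro _ _ _ ⟨N⟩
    exact P.hasEnrichedLift c _
  have := (hi P.proj hp).hasLiftingProperty
  have sq : CommSq (P.lift i h₀ hπ hζ) i P.proj (𝟙 B) := ⟨by rw [P.lift_proj, Category.comp_id]⟩
  refine ⟨sq.lift.app n ≫ P.point, ?_, ?_, ?_⟩
  · rw [← Category.assoc, ← NatTrans.comp_app, sq.fac_left, P.lift_point]
  · rw [Category.assoc, P.point_comp, ← NatTrans.comp_app, sq.fac_right, NatTrans.id_app]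
  · rw [Category.assoc, ← Category.assoc, sq.lift.naturality, Category.assoc, P.map_point,
      ← Category.assoc, ← NatTrans.comp_app, sq.fac_right, NatTrans.id_app, Category.id_comp]

lemma Cofibration.isCoproductInclusion_app [FinitaryExtensive E] {A B : SimplicialObject E}
    {i : A ⟶ B} (hi : Cofibration i) (n : SimplexCategoryᵒᵖ) : IsCoproductInclusion (i.app n) := by
  obtain ⟨h, hih, hπ, -⟩ := hi.exists_lift (s := 𝟙 n) (ζ := terminal.from _)
    { retraction := 𝟙 n
      comp_retraction := Category.comp_id _
      sec := coprod.inr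
      sec_comp := coprod.inr_desc _ _
      mapSec := coprod.inr
      mapSec_comp := by rw [coprod.inr_desc, B.map_id]
      mapSec_cond := rfl }
    (coprod.inl : A.obj n ⟶ A.obj n ⨿ B.obj n) (coprod.inl_desc (i.app n) _)
    (Subsingleton.elim _ _)
  exact isCoproductInclusion_of_lift (i.app n) h hih hπ

omit [HasFiniteLimits E] in
lemma nonempty_isInitial_initial_obj (j : SimplexCategoryᵒᵖ) :
    Nonempty (IsInitial ((⊥_ (SimplicialObject E)).obj j)) :=
  ⟨IsInitial.isInitialObj ((evaluation SimplexCategoryᵒᵖ E).obj j) _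
    (initialIsInitial (C := SimplicialObject E))⟩

lemma Cofibrant.isCoproductInclusion_map [FinitaryExtensive E] {X : SimplicialObject E}
    (hX : Cofibrant X) {m n : SimplexCategoryᵒᵖ} {s : m ⟶ n} {r : n ⟶ m} (hsr : s ≫ r = 𝟙 m) :
    IsCoproductInclusion (X.map s) := by
  have hinit (j : SimplexCategoryᵒᵖ) : IsInitial ((⊥_ (SimplicialObject E)).obj j) :=
    (nonempty_isInitial_initial_obj j).some
  obtain ⟨h, -, hπ, hζ⟩ := Cofibration.exists_lift hX (s := s)
    (ζ := 𝟙 (X.obj m ⨿ X.obj n))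
    { retraction := r
      comp_retraction := hsr
      sec := coprod.inr
      sec_comp := coprod.inr_desc (X.map s) _
      mapSec := coprod.inl
      mapSec_comp := coprod.inl_desc _ _
      mapSec_cond := Category.comp_id _ }
    ((hinit n).to _) ((hinit n).hom_ext _ _) ((hinit m).hom_ext _ _)
  exact isCoproductInclusion_of_lift (X.map s) h (by rwa [Category.comp_id] at hζ) hπ

end TestFibrations

section Canonical

/-- A lift is canonical, for a natural section of the pullback hom, if it is the value of the
section at its own lifting problem. -/
def HasEnrichedLift.IsCanonical {E : Type u} [Category.{v} E] [HasFiniteLimits E] {D : Type w}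
    [Category.{w'} D] {A B X Y : D ⥤ E} {i : A ⟶ B} {p : X ⟶ Y} (h : HasEnrichedLift i p) {e : E}
    (l : tensor e B ⟶ X) : Prop :=
  h.lift (tensorMapRight e i ≫ l) (l ≫ p) (Category.assoc _ _ _) = l

variable {E : Type u} [Category.{v} E] {P Q : SimplicialObject E}

/-- A choice of canonical simplices of `P`, stable under change of parameters, such that every
boundary filling problem against `p` has exactly one canonical solution. -/
structure CanonicalSimplices (p : P ⟶ Q) where
  /-- The condition singling out the canonical simplices. -/
  IsCanonical : ∀ ⦃m : SimplexCategory⦄ ⦃T : E⦄, (T ⟶ P.obj (op m)) → Prop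
  precomp : ∀ ⦃m : SimplexCategory⦄ ⦃T T' : E⦄ (u : T' ⟶ T) (y : T ⟶ P.obj (op m)),
    IsCanonical y → IsCanonical (u ≫ y)
  existsUnique : ∀ ⦃m : SimplexCategory⦄ ⦃T : E⦄ (base : T ⟶ Q.obj (op m))
    (face : ∀ ⦃k : SimplexCategory⦄ (σ : k ⟶ m), ¬ Epi σ → (T ⟶ P.obj (op k))),
    (∀ ⦃k' k : SimplexCategory⦄ (ρ : k' ⟶ k) (σ : k ⟶ m) (h : ¬ Epi σ) (h' : ¬ Epi (ρ ≫ σ)),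
      face (ρ ≫ σ) h' = face σ h ≫ P.map ρ.op) →
    (∀ ⦃k : SimplexCategory⦄ (σ : k ⟶ m) (h : ¬ Epi σ),
      face σ h ≫ p.app (op k) = base ≫ Q.map σ.op) →
    ∃! y : T ⟶ P.obj (op m), y ≫ p.app (op m) = base ∧
      (∀ ⦃k : SimplexCategory⦄ (σ : k ⟶ m) (h : ¬ Epi σ), y ≫ P.map σ.op = face σ h) ∧
      IsCanonical y

section SimplexHom

variable [HasFiniteLimits E] [HasCountableCoproducts E] [FinitaryPreExtensive E] {n : ℕ}
  {T T' : E}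

/-- The morphism `T × Δ[n] ⟶ P` which corresponds to an `n`-simplex of `P` by the Yoneda lemma. -/
def simplexHom (y : T ⟶ P.obj (op ⦋n⦌)) : tensor T (fset E Δ[n]) ⟶ P :=
  simplicialDesc (fun _ τ => y ≫ P.map (SSet.stdSimplex.objEquiv τ).op) fun _ _ f τ => by
    rw [Category.assoc, ← P.map_comp]
    rfl

lemma simplexPoint_simplexHom (y : T ⟶ P.obj (op ⦋n⦌)) {k : SimplexCategoryᵒᵖ}
    (τ : (Δ[n] : SSet.{0}).obj k) :
    simplexPoint T τ ≫ (simplexHom y).app k = y ≫ P.map (SSet.stdSimplex.objEquiv τ).op :=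
  simplexPoint_simplicialDesc _ _ τ

lemma simplexPoint_id_simplexHom (y : T ⟶ P.obj (op ⦋n⦌)) :
    simplexPoint T (SSet.stdSimplex.objEquiv.symm (𝟙 ⦋n⦌)) ≫ (simplexHom y).app (op ⦋n⦌) = y := by
  rw [simplexPoint_simplexHom, Equiv.apply_symm_apply, op_id, P.map_id, Category.comp_id]

lemma simplexHom_simplexPoint_id (l : tensor T (fset E Δ[n]) ⟶ P) :
    simplexHom (simplexPoint T (SSet.stdSimplex.objEquiv.symm (𝟙 ⦋n⦌)) ≫ l.app (op ⦋n⦌)) = l := by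
  refine tensor_fset_hom_ext fun k τ => ?_
  rw [simplexPoint_simplexHom, Category.assoc, ← l.naturality, ← Category.assoc, simplexPoint_map]
  congr 2
  exact congrArg SSet.stdSimplex.objEquiv.symm (Category.comp_id (SSet.stdSimplex.objEquiv τ))

lemma simplexHom_injective :
    Function.Injective (simplexHom : (T ⟶ P.obj (op ⦋n⦌)) → (tensor T (fset E Δ[n]) ⟶ P)) :=
  fun y y' h => by rw [← simplexPoint_id_simplexHom y, h, simplexPoint_id_simplexHom]

lemma simplexHom_comp (y : T ⟶ P.obj (op ⦋n⦌)) (p : P ⟶ Q) :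
    simplexHom y ≫ p = simplexHom (y ≫ p.app (op ⦋n⦌)) := by
  rw [← simplexHom_simplexPoint_id (simplexHom y ≫ p), NatTrans.comp_app, ← Category.assoc,
    simplexPoint_id_simplexHom]

lemma tensorMapLeft_simplexHom (u : T' ⟶ T) (y : T ⟶ P.obj (op ⦋n⦌)) :
    tensorMapLeft u _ ≫ simplexHom y = simplexHom (u ≫ y) := by
  rw [← simplexHom_simplexPoint_id (tensorMapLeft u _ ≫ simplexHom y), NatTrans.comp_app,
    ← Category.assoc, simplexPoint_tensorMapLeft, Category.assoc, simplexPoint_id_simplexHom]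

lemma not_epi_objEquiv {k : SimplexCategoryᵒᵖ} (τ : (∂Δ[n] : SSet.{0}).obj k) :
    ¬ Epi (SSet.stdSimplex.objEquiv τ.1) := by
  rw [SimplexCategory.epi_iff_surjective]
  exact τ.2

lemma map_simplexHom_eq_iff {l : tensor T (fset E ∂Δ[n]) ⟶ P} {y : T ⟶ P.obj (op ⦋n⦌)} :
    tensorMapRight T (fsetMap E (∂Δ[n] : (Δ[n] : SSet.{0}).Subcomplex).ι) ≫ simplexHom y = l ↔
      ∀ (k : SimplexCategoryᵒᵖ) (τ : (∂Δ[n] : SSet.{0}).obj k),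
        y ≫ P.map (SSet.stdSimplex.objEquiv τ.1).op = simplexPoint T τ ≫ l.app k := by
  have key (k : SimplexCategoryᵒᵖ) (τ : (∂Δ[n] : SSet.{0}).obj k) :
      simplexPoint T τ ≫ (tensorMapRight T (fsetMap E ∂Δ[n].ι) ≫ simplexHom y).app k =
        y ≫ P.map (SSet.stdSimplex.objEquiv τ.1).op := by
    rw [NatTrans.comp_app, ← Category.assoc, simplexPoint_tensorMapRight]
    exact simplexPoint_simplexHom y _
  refine ⟨fun h k τ => by rw [← h, key], fun h => tensor_fset_hom_ext fun k τ => ?_⟩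
  rw [key, h]

lemma existsUnique_isCanonical {p : P ⟶ Q}
    (h : HasEnrichedLift (fsetMap E (∂Δ[n] : (Δ[n] : SSet.{0}).Subcomplex).ι) p)
    (base : T ⟶ Q.obj (op ⦋n⦌))
    (face : ∀ ⦃k : SimplexCategory⦄ (σ : k ⟶ ⦋n⦌), ¬ Epi σ → (T ⟶ P.obj (op k)))
    (face_comp : ∀ ⦃k' k : SimplexCategory⦄ (ρ : k' ⟶ k) (σ : k ⟶ ⦋n⦌) (h : ¬ Epi σ)
      (h' : ¬ Epi (ρ ≫ σ)), face (ρ ≫ σ) h' = face σ h ≫ P.map ρ.op)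
    (face_base : ∀ ⦃k : SimplexCategory⦄ (σ : k ⟶ ⦋n⦌) (h : ¬ Epi σ),
      face σ h ≫ p.app (op k) = base ≫ Q.map σ.op) :
    ∃! y : T ⟶ P.obj (op ⦋n⦌), y ≫ p.app (op ⦋n⦌) = base ∧
      (∀ ⦃k : SimplexCategory⦄ (σ : k ⟶ ⦋n⦌) (h : ¬ Epi σ), y ≫ P.map σ.op = face σ h) ∧
      h.IsCanonical (simplexHom y) := by
  let a : tensor T (fset E ∂Δ[n]) ⟶ P :=
    simplicialDesc (fun k τ => face (SSet.stdSimplex.objEquiv τ.1) (not_epi_objEquiv τ))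
      fun k k' f τ => (face_comp f.unop _ (not_epi_objEquiv τ)
        (not_epi_objEquiv ((∂Δ[n] : SSet.{0}).map f τ))).symm
  have face_eq (k : SimplexCategoryᵒᵖ) (τ : (∂Δ[n] : SSet.{0}).obj k) :
      simplexPoint T τ ≫ a.app k = face (SSet.stdSimplex.objEquiv τ.1) (not_epi_objEquiv τ) :=
    simplexPoint_simplicialDesc _ _ τ
  have ha (y : T ⟶ P.obj (op ⦋n⦌)) : tensorMapRight T (fsetMap E ∂Δ[n].ι) ≫ simplexHom y = a ↔
      ∀ ⦃k : SimplexCategory⦄ (σ : k ⟶ ⦋n⦌) (h : ¬ Epi σ), y ≫ P.map σ.op = face σ h := by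
    refine map_simplexHom_eq_iff.trans ⟨fun hy k σ hσ => ?_, fun hy k τ =>
      (hy _ (not_epi_objEquiv τ)).trans (face_eq k τ).symm⟩
    exact (hy (op k) ⟨SSet.stdSimplex.objEquiv.symm σ, fun hσ' =>
      hσ (SimplexCategory.epi_iff_surjective.2 hσ')⟩).trans (face_eq (op k) _)
  have hab : a ≫ p = tensorMapRight T (fsetMap E ∂Δ[n].ι) ≫ simplexHom base := by
    refine (map_simplexHom_eq_iff.2 fun k τ => ?_).symm
    exact ((Category.assoc _ _ _).symm.trans ((congrArg (· ≫ p.app k) (face_eq k τ)).trans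
      (face_base _ _))).symm
  obtain ⟨y, hy⟩ : ∃ y, simplexHom y = h.lift a (simplexHom base) hab :=
    ⟨_, simplexHom_simplexPoint_id _⟩
  refine ⟨y, ⟨?_, (ha y).1 (by rw [hy, h.map_lift]), ?_⟩, ?_⟩
  · exact simplexHom_injective (by rw [← simplexHom_comp, hy, h.lift_comp])
  · simp only [HasEnrichedLift.IsCanonical, hy, h.map_lift, h.lift_comp]
  · rintro y' ⟨rfl, hy'face, hy'⟩
    apply simplexHom_injective
    rw [hy, ← hy']
    simp only [(ha y').2 hy'face, simplexHom_comp]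

/-- The canonical simplices of a trivial fibration are its chosen fillings of boundaries. -/
def canonicalSimplices {p : P ⟶ Q} (hp : enrichedFibrations (boundaryInclusions E) p) :
    CanonicalSimplices p where
  IsCanonical m _ y := (hp _ (MorphismProperty.ofHoms.mk m.len)).IsCanonical (simplexHom y)
  precomp m T T' u y hy := by
    rw [← tensorMapLeft_simplexHom]
    refine Eq.trans ?_ (congrArg (tensorMapLeft u _ ≫ ·) hy)
    simp only [HasEnrichedLift.lift_naturality, ← Category.assoc, tensorMap_comm]
  existsUnique m _ base face face_comp face_base := existsUnique_isCanonical (n := m.len)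
    (hp _ (MorphismProperty.ofHoms.mk m.len)) base face face_comp face_base

end SimplexHom

end Canonical

section Degenerate

lemma exists_splitEpi_mono {m n : SimplexCategory} (σ : m ⟶ n) :
    ∃ (k : SimplexCategory) (ε : m ⟶ k) (δ : k ⟶ n) (γ : k ⟶ m),
      ε ≫ δ = σ ∧ γ ≫ ε = 𝟙 k ∧ Mono δ ∧ (¬ Epi σ → k.len < n.len) := by
  have : IsSplitEpi (factorThruImage σ) := isSplitEpi_of_epi _
  refine ⟨image σ, factorThruImage σ, image.ι σ, section_ (factorThruImage σ), image.fac σ,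
    IsSplitEpi.id _, inferInstance, fun h => ?_⟩
  refine lt_of_le_of_ne (SimplexCategory.len_le_of_mono (image.ι σ)) fun h' => h ?_
  have := (SimplexCategory.isIso_iff_of_mono (image.ι σ)).2 h'
  rw [← image.fac σ]
  infer_instance

variable {E : Type u} [Category.{v} E] {X Y : SimplicialObject E} {m k : SimplexCategory} {T : E}

/-- The sieve of the generalized `m`-simplices of `X` which are fixed by the operator `e`. -/
def fixedSieve (X : SimplicialObject E) {m : SimplexCategory} (e : m ⟶ m) :
    Sieve (X.obj (op m)) where
  arrows _ x := x ≫ X.map e.op = x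
  downward_closed h u := by rw [Category.assoc, h]

lemma fixedSieve_apply {e : m ⟶ m} {x : T ⟶ X.obj (op m)} :
    fixedSieve X e x ↔ x ≫ X.map e.op = x :=
  Iff.rfl

/-- The sieve of the generalized `m`-simplices of `X` which are degenerate as a whole: those which
are fixed by an idempotent operator other than the identity. -/
def degenerateSieve (X : SimplicialObject E) (m : SimplexCategory) : Sieve (X.obj (op m)) :=
  ⨆ e : { e : m ⟶ m // e ≫ e = e ∧ e ≠ 𝟙 m }, fixedSieve X e.1

lemma degenerateSieve_apply {x : T ⟶ X.obj (op m)} :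
    degenerateSieve X m x ↔ ∃ e : m ⟶ m, e ≫ e = e ∧ e ≠ 𝟙 m ∧ fixedSieve X e x := by
  refine ⟨?_, fun ⟨e, he, he', hx⟩ => ⟨_, ⟨⟨e, he, he'⟩, rfl⟩, hx⟩⟩
  rintro ⟨_, ⟨⟨e, he, he'⟩, rfl⟩, hx⟩
  exact ⟨e, he, he', hx⟩

lemma exists_retraction_of_degenerateSieve {x : T ⟶ X.obj (op m)} (hx : degenerateSieve X m x) :
    ∃ (k : SimplexCategory) (ε : m ⟶ k) (δ : k ⟶ m), δ ≫ ε = 𝟙 k ∧ k.len < m.len ∧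
      fixedSieve X (ε ≫ δ) x := by
  obtain ⟨e, he, he', hx⟩ := degenerateSieve_apply.1 hx
  obtain ⟨k, ε, δ, γ, rfl, hγ, _, hk⟩ := exists_splitEpi_mono e
  refine ⟨k, ε, δ, ?_, hk fun _ => he' (SimplexCategory.eq_id_of_epi _), hx⟩
  rw [← cancel_mono δ, Category.assoc]
  simpa [reassoc_of% hγ] using γ ≫= he

lemma degenerateSieve_comp_map {σ : m ⟶ k} (hkm : k.len < m.len) (x : T ⟶ X.obj (op k)) :
    degenerateSieve X m (x ≫ X.map σ.op) := by
  obtain ⟨j, ε, δ, γ, rfl, hγ, _, -⟩ := exists_splitEpi_mono σ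
  refine degenerateSieve_apply.2 ⟨ε ≫ γ, by simp [reassoc_of% hγ], fun h => ?_, ?_⟩
  · have : Mono ε := mono_of_mono_fac h
    exact (((SimplexCategory.len_le_of_mono ε).trans (SimplexCategory.len_le_of_mono δ)).trans_lt
      hkm).false
  · change (x ≫ X.map _) ≫ X.map _ = x ≫ X.map _
    rw [Category.assoc, ← X.map_comp, ← op_comp, Category.assoc, reassoc_of% hγ]

/-- The simplicial set of the simplices of `X` with parameters in `T`. -/
abbrev pointsSSet (X : SimplicialObject E) (T : E) : SSet.{v} :=
  X ⋙ coyoneda.obj (op T)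

lemma eq_of_map_eq_of_not_degenerateSieve {x : T ⟶ X.obj (op m)} (hx : ¬ degenerateSieve X m x)
    {σ τ : k ⟶ m} [Epi σ] (h : x ≫ X.map σ.op = x ≫ X.map τ.op) : σ = τ := by
  have hx' : x ∈ (pointsSSet X T).nonDegenerate m.len := by
    rintro ⟨j, hj, f, y, rfl⟩
    exact hx (degenerateSieve_comp_map hj y)
  exact SSet.unique_nonDegenerate_map (X := pointsSSet X T) (n := k.len)
    (x ≫ X.map σ.op) σ ⟨x, hx'⟩ rfl τ ⟨x, hx'⟩ h

end Degenerate

section CanonicalSimplices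

variable {E : Type u} [Category.{v} E] {X P Q : SimplicialObject E} {p : P ⟶ Q}
  {m : SimplexCategory} {T T' : E}

namespace CanonicalSimplices

variable (c : CanonicalSimplices p)

lemma exists_isCanonical (y : T ⟶ P.obj (op m)) : ∃ y' : T ⟶ P.obj (op m), c.IsCanonical y' ∧
    y' ≫ p.app (op m) = y ≫ p.app (op m) ∧
    ∀ ⦃k : SimplexCategory⦄ (σ : k ⟶ m), ¬ Epi σ → y' ≫ P.map σ.op = y ≫ P.map σ.op := by
  obtain ⟨y', ⟨hbase, hface, hcan⟩, -⟩ := c.existsUnique (y ≫ p.app (op m))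
    (fun _ σ _ => y ≫ P.map σ.op) (fun _ _ _ _ _ _ => by simp) (fun _ _ _ => by simp)
  exact ⟨y', hcan, hbase, hface⟩

variable {c}

lemma eq_of_isCanonical {y y' : T ⟶ P.obj (op m)} (hy : c.IsCanonical y) (hy' : c.IsCanonical y')
    (hbase : y ≫ p.app (op m) = y' ≫ p.app (op m))
    (hface : ∀ ⦃k : SimplexCategory⦄ (σ : k ⟶ m), ¬ Epi σ → y ≫ P.map σ.op = y' ≫ P.map σ.op) :
    y = y' :=
  (c.existsUnique (y' ≫ p.app (op m)) (fun _ σ _ => y' ≫ P.map σ.op)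
    (fun _ _ _ _ _ _ => by simp) (fun _ _ _ => by simp)).unique
    ⟨hbase, hface, hy⟩ ⟨rfl, fun _ _ _ => rfl, hy'⟩

lemma isCanonical_of_isInitial (hT : Nonempty (IsInitial T)) (y : T ⟶ P.obj (op m)) :
    c.IsCanonical y := by
  obtain ⟨y', hy', -⟩ := c.exists_isCanonical y
  rwa [hT.some.hom_ext y y']

lemma isCanonical_of_cover [FinitaryPreExtensive E] {S : Sieve T}
    (hS : S ∈ extensiveTopology E T) {y : T ⟶ P.obj (op m)}
    (h : ∀ ⦃T' : E⦄ (t : T' ⟶ T), S t → c.IsCanonical (t ≫ y)) : c.IsCanonical y := by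
  obtain ⟨y', hy', hbase, hface⟩ := c.exists_isCanonical y
  suffices y = y' by rwa [this]
  refine hom_ext_of_cover hS fun T' t ht =>
    eq_of_isCanonical (h t ht) (c.precomp t y' hy') (by simp [hbase]) fun k σ hσ => ?_
  rw [Category.assoc, Category.assoc, hface σ hσ]

end CanonicalSimplices

variable (c : CanonicalSimplices p) (g : X ⟶ Q)

/-- The simplex `y` of `P` is the value at the simplex `x` of `X` of the canonical lift of `g` along
`p`, i.e. the lift which sends nondegenerate simplices to canonical simplices. This is detected by
the values at the faces of `x`, which makes the notion meaningful before the lift is constructed. -/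
structure IsCanonicalLift (x : T ⟶ X.obj (op m)) (y : T ⟶ P.obj (op m)) : Prop where
  comp : y ≫ p.app (op m) = x ≫ g.app (op m)
  map_eq : ∀ ⦃T' : E⦄ (u : T' ⟶ T) ⦃k : SimplexCategory⦄ (σ τ : k ⟶ m),
    u ≫ x ≫ X.map σ.op = u ≫ x ≫ X.map τ.op → u ≫ y ≫ P.map σ.op = u ≫ y ≫ P.map τ.op
  isCanonical : ∀ ⦃T' : E⦄ (u : T' ⟶ T) ⦃k : SimplexCategory⦄ (σ : k ⟶ m),
    negSieve (degenerateSieve X k) (u ≫ x ≫ X.map σ.op) → c.IsCanonical (u ≫ y ≫ P.map σ.op)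

namespace IsCanonicalLift

variable {c g} {x : T ⟶ X.obj (op m)} {y y' : T ⟶ P.obj (op m)}

lemma precomp (h : IsCanonicalLift c g x y) (u : T' ⟶ T) : IsCanonicalLift c g (u ≫ x) (u ≫ y) where
  comp := by rw [Category.assoc, h.comp, Category.assoc]
  map_eq T'' u' k σ τ := by simpa using h.map_eq (u' ≫ u) σ τ
  isCanonical T'' u' k σ := by simpa using h.isCanonical (u' ≫ u) σ

lemma map (h : IsCanonicalLift c g x y) {k : SimplexCategory} (σ : k ⟶ m) :
    IsCanonicalLift c g (x ≫ X.map σ.op) (y ≫ P.map σ.op) where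
  comp := by rw [Category.assoc, p.naturality, reassoc_of% h.comp, Category.assoc, g.naturality]
  map_eq T' u k τ τ' := by simpa using h.map_eq u (τ ≫ σ) (τ' ≫ σ)
  isCanonical T' u k τ := by simpa using h.isCanonical u (τ ≫ σ)

lemma isCanonical_of_negSieve (h : IsCanonicalLift c g x y)
    (hx : negSieve (degenerateSieve X m) x) : c.IsCanonical y := by
  simpa using h.isCanonical (𝟙 T) (𝟙 m) (by simpa using hx)

lemma fixed (h : IsCanonicalLift c g x y) {e : m ⟶ m} (hx : fixedSieve X e x) :
    fixedSieve P e y := by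
  simpa [fixedSieve_apply] using h.map_eq (𝟙 T) e (𝟙 m) (by simpa [fixedSieve_apply] using hx)

variable [FinitaryPreExtensive E]

lemma of_cover {S : Sieve T} (hS : S ∈ extensiveTopology E T)
    (h : ∀ ⦃T' : E⦄ (t : T' ⟶ T), S t → IsCanonicalLift c g (t ≫ x) (t ≫ y)) :
    IsCanonicalLift c g x y where
  comp := hom_ext_of_cover hS fun T' t ht => by simpa using (h t ht).comp
  map_eq T' u k σ τ hστ := hom_ext_of_cover ((extensiveTopology E).pullback_stable u hS)
    fun T'' t ht => by
      simpa using (h (t ≫ u) ht).map_eq (𝟙 _) σ τ (by simp [hστ])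
  isCanonical T' u k σ hσ :=
    CanonicalSimplices.isCanonical_of_cover ((extensiveTopology E).pullback_stable u hS)
      fun T'' t ht => by
        simpa using (h (t ≫ u) ht).isCanonical (𝟙 _) σ
          (by simpa using Sieve.downward_closed _ hσ t)

variable (hX : ∀ m, IsDecidable (degenerateSieve X m))
include hX

lemma eq (h : IsCanonicalLift c g x y) (h' : IsCanonicalLift c g x y') : y = y' := by
  induction hm : m.len using Nat.strong_induction_on generalizing m T with | _ d ih
  subst hm
  refine hom_ext_of_cover ((extensiveTopology E).pullback_stable x (hX m)) fun T' t ht => ?_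
  have h := h.precomp t
  have h' := h'.precomp t
  have low {j k : SimplexCategory} (hj : j.len < m.len) (ε : k ⟶ j) (δ : j ⟶ m) :
      (t ≫ y) ≫ P.map (ε ≫ δ).op = (t ≫ y') ≫ P.map (ε ≫ δ).op := by
    have := ih _ hj (h.map δ) (h'.map δ) rfl =≫ P.map ε.op
    simpa using this
  rcases ht with ht | ht
  · obtain ⟨k, ε, δ, -, hk, hx⟩ := exists_retraction_of_degenerateSieve ht
    rw [← fixedSieve_apply.1 (h.fixed hx), ← fixedSieve_apply.1 (h'.fixed hx), low hk]
  · refine CanonicalSimplices.eq_of_isCanonical (h.isCanonical_of_negSieve ht)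
      (h'.isCanonical_of_negSieve ht) (h.comp.trans h'.comp.symm) fun k σ hσ => ?_
    obtain ⟨j, ε, δ, -, rfl, -, -, hj⟩ := exists_splitEpi_mono σ
    exact low (hj hσ) ε δ

/-- The faces of `y` along non-epimorphisms are canonical lifts by construction, and the pullbacks
of `x` along epimorphisms are nondegenerate only if these are isomorphisms. -/
lemma of_faces (hx : negSieve (degenerateSieve X m) x) (hy : c.IsCanonical y)
    (hcomp : y ≫ p.app (op m) = x ≫ g.app (op m))
    (hface : ∀ ⦃k : SimplexCategory⦄ (σ : k ⟶ m), ¬ Epi σ →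
      IsCanonicalLift c g (x ≫ X.map σ.op) (y ≫ P.map σ.op)) : IsCanonicalLift c g x y where
  comp := hcomp
  map_eq T' u k σ τ h := by
    by_cases hu : degenerateSieve X m (u ≫ x)
    · exact (hx u hu).some.hom_ext _ _
    by_cases hσ : Epi σ
    · rw [eq_of_map_eq_of_not_degenerateSieve hu (σ := σ) (τ := τ) (by simpa using h)]
    by_cases hτ : Epi τ
    · rw [eq_of_map_eq_of_not_degenerateSieve hu (σ := τ) (τ := σ) (by simpa using h.symm)]
    · exact ((hface σ hσ).precomp u).eq hX (by rw [h]; exact (hface τ hτ).precomp u)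
  isCanonical T' u k σ h := by
    by_cases hσ : Epi σ
    · by_cases hlen : m.len < k.len
      · exact CanonicalSimplices.isCanonical_of_isInitial (nonempty_isInitial_of_negSieve
          (by simpa using degenerateSieve_comp_map (σ := σ) hlen (u ≫ x)) h) _
      · have := (SimplexCategory.isIso_iff_of_epi σ).2
          ((SimplexCategory.len_le_of_epi σ).antisymm (not_lt.1 hlen)).symm
        obtain rfl : k = m := SimplexCategory.ext (SimplexCategory.len_eq_of_isIso σ)
        rw [SimplexCategory.eq_id_of_isIso σ]
        simpa using c.precomp u y hy
    · exact ((hface σ hσ).precomp u).isCanonical_of_negSieve h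

end IsCanonicalLift

section Exists

variable [FinitaryPreExtensive E] {c g} (hX : ∀ m, IsDecidable (degenerateSieve X m))
include hX

lemma exists_isCanonicalLift_of_faces {x : T ⟶ X.obj (op m)}
    (hx : negSieve (degenerateSieve X m) x)
    (hface : ∀ ⦃k : SimplexCategory⦄ (σ : k ⟶ m), ¬ Epi σ →
      ∃ y, IsCanonicalLift c g (x ≫ X.map σ.op) y) : ∃ y, IsCanonicalLift c g x y := by
  choose face hface using hface
  obtain ⟨y, ⟨hbase, hy, hcan⟩, -⟩ := c.existsUnique (x ≫ g.app (op m)) face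
    (fun k' k ρ σ h h' => (hface _ h').eq hX (by simpa using (hface σ h).map ρ))
    (fun k σ h => by simp [(hface σ h).comp])
  exact ⟨y, .of_faces hX hx hcan hbase fun k σ hσ => by rw [hy σ hσ]; exact hface σ hσ⟩

lemma exists_isCanonicalLift (x : T ⟶ X.obj (op m)) : ∃ y, IsCanonicalLift c g x y := by
  induction hm : m.len using Nat.strong_induction_on generalizing m T with | _ d ih
  subst hm
  suffices ∀ ⦃T' : E⦄ (t : T' ⟶ T), (degenerateSieve X m ⊔ negSieve (degenerateSieve X m))
      (t ≫ x) → ∃ y, IsCanonicalLift c g (t ≫ x) y by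
    obtain ⟨y, hy, -⟩ := existsUnique_of_cover ((extensiveTopology E).pullback_stable x (hX m))
      (fun _ t y => IsCanonicalLift c g (t ≫ x) y)
      (fun _ _ u t y h => by simpa using h.precomp u) fun T' t ht =>
        existsUnique_of_exists_of_unique (this t ht) fun _ _ h h' => h.eq hX h'
    exact ⟨y, .of_cover ((extensiveTopology E).pullback_stable x (hX m)) hy⟩
  rintro T' t (ht | ht)
  · obtain ⟨k, ε, δ, -, hk, hx⟩ := exists_retraction_of_degenerateSieve ht
    obtain ⟨y, hy⟩ := ih _ hk ((t ≫ x) ≫ X.map δ.op) rfl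
    have hx : ((t ≫ x) ≫ X.map δ.op) ≫ X.map ε.op = t ≫ x := by
      simpa [fixedSieve_apply] using hx
    exact ⟨y ≫ P.map ε.op, by simpa only [hx] using hy.map ε⟩
  · refine exists_isCanonicalLift_of_faces hX ht fun k σ hσ => ?_
    obtain ⟨j, ε, δ, -, rfl, -, -, hj⟩ := exists_splitEpi_mono σ
    obtain ⟨y, hy⟩ := ih _ (hj hσ) ((t ≫ x) ≫ X.map δ.op) rfl
    exact ⟨y ≫ P.map ε.op, by simpa using hy.map ε⟩

variable (c g) in
lemma existsUnique_canonicalLift : ∃! l : X ⟶ P, l ≫ p = g ∧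
    ∀ ⦃m : SimplexCategory⦄ ⦃T : E⦄ (x : T ⟶ X.obj (op m)), negSieve (degenerateSieve X m) x →
      c.IsCanonical (x ≫ l.app (op m)) := by
  choose y hy using fun m => exists_isCanonicalLift (c := c) (g := g) hX (𝟙 (X.obj (op m)))
  refine ⟨{ app := fun m => y m.unop, naturality := fun m k σ => ?_ }, ⟨?_, fun m T x hx => ?_⟩, ?_⟩
  · refine ((hy k.unop).precomp (X.map σ)).eq hX ?_
    simpa using (hy m.unop).map σ.unop
  · ext m
    simpa using (hy m.unop).comp
  · exact ((hy m).precomp x).isCanonical_of_negSieve (by simpa using hx)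
  · rintro l ⟨rfl, hl⟩
    ext ⟨m⟩
    refine IsCanonicalLift.eq hX (c := c) (g := l ≫ p) (x := 𝟙 _) ⟨by simp, ?_, ?_⟩ (hy m)
    · intro T' u k σ τ h
      simp only [← l.naturality, Category.id_comp] at h ⊢
      rw [reassoc_of% h]
    · intro T' u k σ h
      rw [Category.id_comp] at h
      rw [← l.naturality, ← Category.assoc]
      exact hl _ h

end Exists

end CanonicalSimplices

section Cofibrant

variable {E : Type u} [Category.{v} E] [HasFiniteLimits E] {X : SimplicialObject E}

lemma fixedSieve_tensor (e : E) (X : SimplicialObject E) {m : SimplexCategory} (f : m ⟶ m) :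
    fixedSieve (tensor e X) f = (fixedSieve X f).pullback ((tensorSnd e X).app (op m)) := by
  have key {T : E} (x : T ⟶ e ⨯ X.obj (op m)) : x ≫ prod.map (𝟙 e) (X.map f.op) = x ↔
      (x ≫ prod.snd) ≫ X.map f.op = x ≫ prod.snd := by
    rw [Limits.prod.hom_ext_iff]
    simp
  ext T x
  exact key x

lemma degenerateSieve_tensor (e : E) (X : SimplicialObject E) (m : SimplexCategory) :
    degenerateSieve (tensor e X) m =
      (degenerateSieve X m).pullback ((tensorSnd e X).app (op m)) := by
  ext T x
  simp only [Sieve.pullback_apply, degenerateSieve_apply, fixedSieve_tensor]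

variable [HasCountableCoproducts E]

lemma cofibrant_of_isDecidable_degenerateSieve [FinitaryPreExtensive E]
    (hX : ∀ m, IsDecidable (degenerateSieve X m)) : Cofibrant X := by
  intro P Q p hp
  have c := canonicalSimplices hp
  refine hasEnrichedLift_of_existsUnique
    (fun e l => ∀ ⦃m : SimplexCategory⦄ ⦃T : E⦄ (x : T ⟶ (tensor e X).obj (op m)),
      negSieve (degenerateSieve (tensor e X) m) x → c.IsCanonical (x ≫ l.app (op m)))
    (fun e e' t l hl m T x hx => ?_) fun e a b _ => ?_
  · rw [NatTrans.comp_app, ← Category.assoc]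
    refine hl _ ?_
    simp only [degenerateSieve_tensor, negSieve_pullback, Sieve.pullback_apply] at hx ⊢
    rwa [Category.assoc, ← NatTrans.comp_app, tensorMapLeft_tensorSnd]
  · obtain ⟨l, ⟨hlp, hl⟩, hlu⟩ := existsUnique_canonicalLift c b fun m => by
      rw [degenerateSieve_tensor]
      exact (hX m).pullback _
    refine ⟨l, ⟨NatTrans.ext (funext fun m => ?_), hlp, hl⟩, fun l' hl' => hlu l' hl'.2⟩
    exact (nonempty_isInitial_of_hom (nonempty_isInitial_initial_obj m)
      ((tensorSnd e _).app m)).some.hom_ext _ _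

lemma cofibrant_iff_isDecidable_fixedSieve [FinitaryExtensive E] : Cofibrant X ↔
    ∀ ⦃m : SimplexCategory⦄ (e : m ⟶ m), e ≫ e = e → IsDecidable (fixedSieve X e) := by
  refine ⟨fun hX m e he => ?_, fun h => cofibrant_of_isDecidable_degenerateSieve fun m =>
    .iSup fun e => h e.1 e.2.1⟩
  obtain ⟨k, ε, δ, γ, rfl, hγ, _, -⟩ := exists_splitEpi_mono e
  have hδε : δ ≫ ε = 𝟙 k := by
    rw [← cancel_mono δ, Category.assoc]
    simpa [reassoc_of% hγ] using γ ≫= he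
  have : fixedSieve X (ε ≫ δ) = factorSieve (X.map ε.op) := by
    ext T x
    rw [factorSieve_apply]
    refine ⟨fun h => ⟨x ≫ X.map δ.op, by simpa [fixedSieve] using h⟩, ?_⟩
    rintro ⟨y, rfl⟩
    simp [fixedSieve, ← X.map_comp, ← op_comp, hδε]
  rw [this]
  exact (hX.isCoproductInclusion_map (s := ε.op) (r := δ.op)
    (Quiver.Hom.unop_inj hδε)).isDecidable_factorSieve

end Cofibrant

section PartialClassifiers

variable {C : Type u} [Category.{v} C] {U V W : C}

/-- The pushforward of `q : W ⟶ U` along a monomorphism `f : U ⟶ V`: the object over `V` whose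
generalized elements are partial lifts of elements of `V` to `W`, defined where the element of `V`
lies in `U`. Its restriction to `U` is `W` again. -/
structure PartialClassifier (f : U ⟶ V) (q : W ⟶ U) where
  /-- The object of partial lifts. -/
  obj : C
  /-- The element of `V` underlying a partial lift. -/
  proj : obj ⟶ V
  /-- The inclusion of the total lifts. -/
  ι : W ⟶ obj
  isPullback : IsPullback ι q proj f
  existsUnique : ∀ ⦃T K : C⦄ (t : T ⟶ V) (fst : K ⟶ T) (snd : K ⟶ U), IsPullback fst snd t f →
    ∀ g : K ⟶ W, g ≫ q = snd → ∃! y : T ⟶ obj, y ≫ proj = t ∧ fst ≫ y = g ≫ ι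

namespace PartialClassifier

variable {f : U ⟶ V} {q : W ⟶ U} (c : PartialClassifier f q) {T : C}

instance [Mono f] : Mono c.ι := c.isPullback.mono_fst_of_mono

lemma exists_lift {y : T ⟶ c.obj} {a : T ⟶ U} (h : y ≫ c.proj = a ≫ f) :
    ∃ x : T ⟶ W, x ≫ c.ι = y ∧ x ≫ q = a :=
  c.isPullback.exists_lift y a h

lemma factorSieve_ι : factorSieve c.ι = (factorSieve f).pullback c.proj := by
  ext T y
  simp only [Sieve.pullback_apply, factorSieve_apply]
  refine ⟨?_, fun ⟨a, ha⟩ => ?_⟩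
  · rintro ⟨x, rfl⟩
    exact ⟨x ≫ q, by rw [Category.assoc, Category.assoc, c.isPullback.w]⟩
  · obtain ⟨x, hx, -⟩ := c.exists_lift ha.symm
    exact ⟨x, hx⟩

lemma hom_ext [HasPullbacks C] {y y' : T ⟶ c.obj} (h : y ≫ c.proj = y' ≫ c.proj)
    (h' : ∀ ⦃T' : C⦄ (t : T' ⟶ T) (x : T' ⟶ W), t ≫ y = x ≫ c.ι → t ≫ y' = x ≫ c.ι) : y = y' := by
  obtain ⟨g, hg, hgq⟩ := c.exists_lift (y := pullback.fst (y ≫ c.proj) f ≫ y)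
    (by rw [Category.assoc, pullback.condition])
  exact (c.existsUnique (y ≫ c.proj) _ _ (.of_hasPullback _ _) g hgq).unique ⟨rfl, hg.symm⟩
    ⟨h.symm, h' _ _ hg.symm⟩

/-- Total lifts, seen as the restriction to `U` of partial lifts: the counit of the pushforward. -/
def counit [HasPullbacks C] : (Over.pullback f).obj (Over.mk c.proj) ⟶ Over.mk q :=
  Over.homMk c.isPullback.isoPullback.inv (by simp)

lemma counit_left_ι [HasPullbacks C] : c.counit.left ≫ c.ι = pullback.fst c.proj f :=
  c.isPullback.isoPullback_inv_fst

lemma existsUnique_map_comp_counit [HasPullbacks C] [Mono f] {Z : Over V}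
    (h : (Over.pullback f).obj Z ⟶ Over.mk q) :
    ∃! k : Z ⟶ Over.mk c.proj, (Over.pullback f).map k ≫ c.counit = h := by
  have heq (k : Z ⟶ Over.mk c.proj) : (Over.pullback f).map k ≫ c.counit = h ↔
      pullback.fst Z.hom f ≫ k.left = h.left ≫ c.ι := by
    rw [Over.OverMorphism.ext_iff, ← cancel_mono c.ι, Over.comp_left, Category.assoc,
      counit_left_ι]
    exact Eq.congr_left (pullback.lift_fst _ _ _)
  obtain ⟨y, ⟨hyp, hy⟩, hyu⟩ :=
    c.existsUnique Z.hom _ _ (.of_hasPullback _ _) h.left (Over.w h)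
  refine ⟨Over.homMk y hyp, (heq _).2 hy, fun k hk => ?_⟩
  ext
  exact hyu k.left ⟨Over.w k, (heq k).1 hk⟩

/-- The pushforward of `q` along `f`, as an object over `V`, is universal. -/
def isTerminalCounit [HasPullbacks C] [Mono f] :
    IsTerminal (CostructuredArrow.mk c.counit : CostructuredArrow (Over.pullback f) (Over.mk q)) :=
  IsTerminal.ofUniqueHom
    (fun s => CostructuredArrow.homMk (c.existsUnique_map_comp_counit s.hom).choose
      (c.existsUnique_map_comp_counit s.hom).choose_spec.1)
    fun s k => CostructuredArrow.hom_ext _ _ <|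
      (c.existsUnique_map_comp_counit s.hom).choose_spec.2 k.left (CostructuredArrow.w k)

end PartialClassifier

/-- All pushforwards along `f` exist, in the form of objects of partial lifts. -/
def HasPartialClassifiers (f : U ⟶ V) : Prop :=
  ∀ ⦃W : C⦄ (q : W ⟶ U), Nonempty (PartialClassifier f q)

lemma HasPartialClassifiers.exponentiable [HasPullbacks C] {f : U ⟶ V} [Mono f]
    (h : HasPartialClassifiers f) : Exponentiable f :=
  isLeftAdjoint_iff_hasTerminal_costructuredArrow.2 fun X =>
    (h X.hom).some.isTerminalCounit.hasTerminal

lemma PartialClassifier.nonempty_iso_rightAdjoint_obj [HasPullbacks C] {f : U ⟶ V} [Mono f]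
    {G : Over U ⥤ Over V} (adj : Over.pullback f ⊣ G) {X : Over U}
    (c : PartialClassifier f X.hom) : Nonempty ((G.obj X).left ≅ c.obj) :=
  ⟨(CostructuredArrow.proj _ _ ⋙ Over.forget V).mapIso
    ((mkTerminalOfRightAdjoint _ adj X).uniqueUpToIso c.isTerminalCounit)⟩

/-- Partial lifts to an arbitrary object `Z` reduce equalities of morphisms which are only defined
over `U` to equalities of morphisms which are defined everywhere. -/
lemma HasPartialClassifiers.exists_eq_iff [HasFiniteLimits C] {f : U ⟶ V} [Mono f]
    (hf : HasPartialClassifiers f) {S K Z : C} {t : S ⟶ V} {fst : K ⟶ S} {snd : K ⟶ U}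
    (hK : IsPullback fst snd t f) (a b : K ⟶ Z) :
    ∃ (Z' : C) (a' b' : S ⟶ Z'), ∀ ⦃T : C⦄ (s : T ⟶ S), s ≫ a' = s ≫ b' ↔
      ∀ ⦃T' : C⦄ (u : T' ⟶ T) (k : T' ⟶ K), k ≫ fst = u ≫ s → k ≫ a = k ≫ b := by
  obtain ⟨c⟩ := hf (prod.snd : Z ⨯ U ⟶ U)
  obtain ⟨a', ⟨ha't, ha'⟩, -⟩ := c.existsUnique t fst snd hK (prod.lift a snd) (prod.lift_snd _ _)
  obtain ⟨b', ⟨hb't, hb'⟩, -⟩ := c.existsUnique t fst snd hK (prod.lift b snd) (prod.lift_snd _ _)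
  refine ⟨c.obj, a', b', fun T s => ⟨fun h T' u k hk => ?_, fun h => ?_⟩⟩
  · have : k ≫ prod.lift a snd = k ≫ prod.lift b snd := by
      rw [← cancel_mono c.ι, Category.assoc, Category.assoc, ← ha', ← hb', reassoc_of% hk,
        reassoc_of% hk, h]
    rw [← prod.lift_fst a snd, reassoc_of% this, prod.lift_fst]
  · refine c.hom_ext (by rw [Category.assoc, Category.assoc, ha't, hb't]) fun T' u x hx => ?_
    obtain ⟨k, hk, -⟩ := hK.exists_lift (u ≫ s) (x ≫ prod.snd) (by
      simpa [ha't, c.isPullback.w] using hx =≫ c.proj)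
    have hxa : k ≫ prod.lift a snd = x := by
      rw [← cancel_mono c.ι, ← hx, Category.assoc, ← ha', reassoc_of% hk]
    have hxb : k ≫ prod.lift b snd = x := by
      rw [← hxa, prod.comp_lift, prod.comp_lift, h u k hk]
    rw [← hxb, Category.assoc, ← hb', reassoc_of% hk]

section Extensive

variable [FinitaryExtensive C]

/-- Away from `U` a partial lift carries no information: if `U'` is the complement of `U`, the
partial lifts of elements of `V` to `W` are the elements of `W ⨿ U'`. -/
lemma IsCoproductInclusion.hasPartialClassifiers [HasPullbacks C] {f : U ⟶ V}
    (hf : IsCoproductInclusion f) : HasPartialClassifiers f := by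
  intro W q
  obtain ⟨U', f', ⟨h⟩⟩ := hf
  obtain ⟨hinl, hinr⟩ := (isColimit_iff_isPullback h (coprod.inl_desc (q ≫ f) f')
    ((coprod.inr_desc (q ≫ f) f').trans (Category.id_comp f').symm)).1 ⟨coprodIsCoprod W U'⟩
  refine ⟨⟨W ⨿ U', coprod.desc (q ≫ f) f', coprod.inl, hinl, fun T K t fst snd hK g hg => ?_⟩⟩
  have hK' := IsPullback.of_hasPullback t f'
  obtain ⟨hT⟩ := (isColimit_iff_isPullback h hK.w hK'.w).2 ⟨hK, hK'⟩
  obtain ⟨y : T ⟶ W ⨿ U', hyl : fst ≫ y = g ≫ coprod.inl,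
    hyr : pullback.fst t f' ≫ y = pullback.snd t f' ≫ coprod.inr⟩ :=
    BinaryCofan.IsColimit.desc' hT (g ≫ coprod.inl) (pullback.snd t f' ≫ coprod.inr)
  refine ⟨y, ⟨BinaryCofan.IsColimit.hom_ext hT ?_ ?_, hyl⟩, fun y' ⟨hy't, hy'⟩ =>
    BinaryCofan.IsColimit.hom_ext hT (hy'.trans hyl.symm) (Eq.trans ?_ hyr.symm)⟩
  · change fst ≫ y ≫ _ = fst ≫ t
    rw [reassoc_of% hyl, coprod.inl_desc, reassoc_of% hg, hK.w]
  · change pullback.fst t f' ≫ y ≫ _ = pullback.fst t f' ≫ t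
    rw [reassoc_of% hyr, coprod.inr_desc, hK'.w]
  · obtain ⟨a, ha, ha'⟩ := hinr.exists_lift (pullback.fst t f' ≫ y') (pullback.snd t f')
      (by rw [Category.assoc, hy't, pullback.condition])
    rw [← ha', Category.comp_id]
    exact ha.symm

end Extensive

end PartialClassifiers

section Restriction

variable {E : Type u} [Category.{v} E] {A B X : SimplicialObject E} {i : A ⟶ B} {q : X ⟶ A}
  {Y : ∀ k : SimplexCategory, PartialClassifier (i.app (op k)) (q.app (op k))}

/-- Between the partial lifts of simplices of `B` to simplices of `X` there are no simplicial
operators, since the simplicial operators of `B` may enlarge the domain of definition. The relation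
`IsRestriction ρ y y'` says that the partial lift `y'` lies over `y ∘ ρ`, and agrees with it where
`y` is defined. -/
structure IsRestriction {k k' : SimplexCategory} (ρ : k' ⟶ k) {T : E} (y : T ⟶ (Y k).obj)
    (y' : T ⟶ (Y k').obj) : Prop where
  proj : y' ≫ (Y k').proj = y ≫ (Y k).proj ≫ B.map ρ.op
  map : ∀ ⦃T' : E⦄ (t : T' ⟶ T) (x : T' ⟶ X.obj (op k)), t ≫ y = x ≫ (Y k).ι →
    t ≫ y' = x ≫ X.map ρ.op ≫ (Y k').ι

variable {k k' l : SimplexCategory} {ρ : k' ⟶ k} {T : E} {y : T ⟶ (Y k).obj} {y' : T ⟶ (Y k').obj}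

/-- A degeneracy of a simplex of `B` lies in `A` only if the simplex itself does. -/
lemma exists_lift_of_section [∀ n, Mono (i.app n)] {γ : k ⟶ k'} (hγ : γ ≫ ρ = 𝟙 k)
    {a : T ⟶ A.obj (op k')} (ha : y ≫ (Y k).proj ≫ B.map ρ.op = a ≫ i.app (op k')) :
    ∃ x : T ⟶ X.obj (op k), y = x ≫ (Y k).ι ∧ x ≫ X.map ρ.op ≫ q.app (op k') = a := by
  have hγ' : B.map ρ.op ≫ B.map γ.op = 𝟙 _ := by
    rw [← B.map_comp, ← op_comp, hγ, op_id, B.map_id]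
  obtain ⟨x, hx, -⟩ := (Y k).exists_lift (y := y) (a := a ≫ A.map γ.op) (by
    rw [Category.assoc, i.naturality, ← reassoc_of% ha, hγ', Category.comp_id])
  refine ⟨x, hx.symm, ?_⟩
  rw [← cancel_mono (i.app (op k')), ← ha, ← hx, q.naturality, Category.assoc, Category.assoc,
    Category.assoc, i.naturality, (Y k).isPullback.w_assoc]

namespace IsRestriction

lemma precomp (h : IsRestriction ρ y y') {T' : E} (t : T' ⟶ T) :
    IsRestriction ρ (t ≫ y) (t ≫ y') where
  proj := by simp only [Category.assoc, h.proj]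
  map T'' t' x hx := by
    rw [← Category.assoc, h.map (t' ≫ t) x (by rw [Category.assoc, hx])]

lemma comp {ρ' : l ⟶ k'} {y'' : T ⟶ (Y l).obj} (h : IsRestriction ρ y y')
    (h' : IsRestriction ρ' y' y'') : IsRestriction (ρ' ≫ ρ) y y'' where
  proj := by rw [h'.proj, reassoc_of% h.proj, op_comp, B.map_comp]
  map T' t x hx := by
    rw [h'.map t (x ≫ X.map ρ.op) (by rw [h.map t x hx, Category.assoc]), op_comp, X.map_comp,
      Category.assoc, Category.assoc]

lemma of_total [∀ n, Mono (i.app n)] (x : T ⟶ X.obj (op k)) (ρ : k' ⟶ k) :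
    IsRestriction ρ (x ≫ (Y k).ι) (x ≫ X.map ρ.op ≫ (Y k').ι) where
  proj := by simp [(Y k).isPullback.w_assoc, (Y k').isPullback.w]
  map T' t x' hx' := by
    rw [← Category.assoc, cancel_mono] at hx'
    rw [← hx', Category.assoc]

section Degeneracies

variable [∀ n, Mono (i.app n)] {γ : k ⟶ k'} (hγ : γ ≫ ρ = 𝟙 k)
include hγ

lemma eq [HasPullbacks E] {z : T ⟶ (Y k').obj} (h : IsRestriction ρ y y')
    (hz : IsRestriction ρ y z) : y' = z := by
  refine (Y k').hom_ext (h.proj.trans hz.proj.symm) fun T' t x hx => ?_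
  obtain ⟨x', hx', -⟩ := exists_lift_of_section hγ (y := t ≫ y) (a := x ≫ q.app (op k')) (by
    rw [Category.assoc, ← h.proj, reassoc_of% hx, (Y k').isPullback.w, Category.assoc])
  rw [hz.map t x' hx', ← h.map t x' hx', hx]

lemma exists_of_section [HasPullbacks E] (y : T ⟶ (Y k).obj) :
    ∃ y' : T ⟶ (Y k').obj, IsRestriction ρ y y' := by
  have hK := IsPullback.of_hasPullback (y ≫ (Y k).proj ≫ B.map ρ.op) (i.app (op k'))
  obtain ⟨x, hx, hxq⟩ := exists_lift_of_section hγ (y := pullback.fst _ _ ≫ y)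
    (by simpa only [Category.assoc] using hK.w)
  obtain ⟨y', ⟨hy', hxy'⟩, -⟩ := (Y k').existsUnique _ _ _ hK (x ≫ X.map ρ.op)
    (by rw [Category.assoc, hxq])
  refine ⟨y', hy', fun T' t x' hx' => ?_⟩
  obtain ⟨r, hr, -⟩ := hK.exists_lift t (x' ≫ X.map ρ.op ≫ q.app _) (by
    rw [reassoc_of% hx', (Y k).isPullback.w_assoc, Category.assoc, Category.assoc, ← i.naturality,
      q.naturality_assoc])
  have hrx : r ≫ x = x' := by
    rw [← cancel_mono (Y k).ι, Category.assoc, ← hx, reassoc_of% hr, hx']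
  rw [← hr, Category.assoc, hxy', ← hrx]
  simp only [Category.assoc]

/-- Restricting along the degeneracy `ρ` loses no information. -/
lemma of_comp {ρ' : l ⟶ k'} {y'' : T ⟶ (Y l).obj} (h : IsRestriction ρ y y')
    (h' : IsRestriction (ρ' ≫ ρ) y y'') : IsRestriction ρ' y' y'' where
  proj := by rw [h'.proj, reassoc_of% h.proj, op_comp, B.map_comp]
  map T' t x hx := by
    obtain ⟨x', hx', -⟩ := exists_lift_of_section hγ (y := t ≫ y) (a := x ≫ q.app (op k')) (by
      rw [Category.assoc, ← h.proj, reassoc_of% hx, (Y k').isPullback.w, Category.assoc])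
    have hxx' : x = x' ≫ X.map ρ.op := by
      rw [← cancel_mono (Y k').ι, ← hx, h.map t x' hx', Category.assoc]
    rw [h'.map t x' hx', hxx', op_comp, X.map_comp, Category.assoc, Category.assoc]

end Degeneracies

lemma exists_eq_iff [HasFiniteLimits E] [∀ n, Mono (i.app n)]
    (hi : HasPartialClassifiers (i.app (op k))) (ρ : k' ⟶ k) (y : T ⟶ (Y k).obj)
    (y' : T ⟶ (Y k').obj) : ∃ (Z : E) (a b : T ⟶ Z), ∀ ⦃T' : E⦄ (t : T' ⟶ T),
      t ≫ a = t ≫ b ↔ IsRestriction ρ (t ≫ y) (t ≫ y') := by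
  have hK := IsPullback.of_hasPullback (y ≫ (Y k).proj) (i.app (op k))
  obtain ⟨x, hx, -⟩ := (Y k).exists_lift (y := pullback.fst _ _ ≫ y)
    (by simpa only [Category.assoc] using hK.w)
  obtain ⟨Z, a, b, hab⟩ := hi.exists_eq_iff hK (pullback.fst _ _ ≫ y') (x ≫ X.map ρ.op ≫ (Y k').ι)
  refine ⟨B.obj (op k') ⨯ Z, prod.lift (y' ≫ (Y k').proj) a,
    prod.lift (y ≫ (Y k).proj ≫ B.map ρ.op) b, fun T' t => ?_⟩
  rw [prod.comp_lift, prod.comp_lift, Limits.prod.hom_ext_iff, prod.lift_fst, prod.lift_fst,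
    prod.lift_snd, prod.lift_snd, hab]
  refine ⟨fun ⟨hp, hx'⟩ => ⟨by simpa only [Category.assoc] using hp, fun T'' u z hz => ?_⟩,
    fun h => ⟨by simpa only [Category.assoc] using h.proj, fun T'' u r hr => ?_⟩⟩
  · obtain ⟨r, hr, -⟩ := hK.exists_lift (u ≫ t) (z ≫ q.app (op k)) (by
      simpa [(Y k).isPullback.w] using hz =≫ (Y k).proj)
    have hrx : r ≫ x = z := by
      rw [← cancel_mono (Y k).ι, ← hz, Category.assoc, hx, reassoc_of% hr]
    rw [← hrx, Category.assoc, ← hx' u r hr, reassoc_of% hr]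
  · have := h.map u (r ≫ x) (by rw [Category.assoc, hx, reassoc_of% hr])
    rw [reassoc_of% hr, this, Category.assoc]

end IsRestriction

end Restriction

section PartialSimplices

variable {E : Type u} [Category.{v} E] {A B X : SimplicialObject E} {i : A ⟶ B} {q : X ⟶ A}
  {Y : ∀ k : SimplexCategory, PartialClassifier (i.app (op k)) (q.app (op k))}

variable (Y) in
/-- A family of `n`-simplices, parametrized by `T`, of the pushforward of `q : X ⟶ A` along
`i : A ⟶ B`: an `n`-simplex of `B` together with, for each simplex of `Δ[n]`, a lift to `X` which
is defined where the corresponding face of the given simplex of `B` lies in `A`. -/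
@[ext]
structure PartialSimplex (n : SimplexCategory) (T : E) where
  /-- The partial lift over a simplex of `Δ[n]`. -/
  val : ∀ ⦃k : SimplexCategory⦄, (k ⟶ n) → (T ⟶ (Y k).obj)
  isRestriction : ∀ ⦃k k' : SimplexCategory⦄ (ρ : k' ⟶ k) (σ : k ⟶ n),
    IsRestriction ρ (val σ) (val (ρ ≫ σ))

namespace PartialSimplex

variable {n n' : SimplexCategory} {T T' : E}

/-- Reparametrization of a family of partial simplices. -/
@[simps]
def precomp (F : PartialSimplex Y n T) (t : T' ⟶ T) : PartialSimplex Y n T' where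
  val _ σ := t ≫ F.val σ
  isRestriction _ _ ρ σ := (F.isRestriction ρ σ).precomp t

/-- The action of the simplicial operators on partial simplices. -/
@[simps]
def map (F : PartialSimplex Y n T) (τ : n' ⟶ n) : PartialSimplex Y n' T where
  val _ σ := F.val (σ ≫ τ)
  isRestriction _ _ ρ σ := by simpa only [Category.assoc] using F.isRestriction ρ (σ ≫ τ)

section Degeneracies

variable [HasPullbacks E] [∀ n, Mono (i.app n)]

/-- A partial simplex is determined by the values on the simplices of `Δ[n]` of dimension at most
`n`, since the others are degenerate. -/
lemma ext_of_le {F F' : PartialSimplex Y n T}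
    (h : ∀ ⦃k : SimplexCategory⦄, k.len ≤ n.len → ∀ σ : k ⟶ n, F.val σ = F'.val σ) : F = F' := by
  ext k σ
  obtain ⟨m, ε, δ, γ, rfl, hγ, hδ, -⟩ := exists_splitEpi_mono σ
  exact (F.isRestriction ε δ).eq hγ
    (h (SimplexCategory.len_le_of_mono δ) δ ▸ F'.isRestriction ε δ)

lemma exists_of_le (y : ∀ ⦃k : SimplexCategory⦄, k.len ≤ n.len → (k ⟶ n) → (T ⟶ (Y k).obj))
    (hy : ∀ ⦃k k' : SimplexCategory⦄ (hk : k.len ≤ n.len) (hk' : k'.len ≤ n.len) (ρ : k' ⟶ k)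
      (σ : k ⟶ n), IsRestriction ρ (y hk σ) (y hk' (ρ ≫ σ))) :
    ∃ F : PartialSimplex Y n T, ∀ ⦃k : SimplexCategory⦄ (hk : k.len ≤ n.len) (σ : k ⟶ n),
      F.val σ = y hk σ := by
  choose m ε δ γ hεδ hγ hδ _ using fun (k : SimplexCategory) (σ : k ⟶ n) => exists_splitEpi_mono σ
  have hm (k : SimplexCategory) (σ : k ⟶ n) : (m k σ).len ≤ n.len :=
    have := hδ k σ
    SimplexCategory.len_le_of_mono (δ k σ)
  choose val hval using fun (k : SimplexCategory) (σ : k ⟶ n) =>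
    IsRestriction.exists_of_section (hγ k σ) (y (hm k σ) (δ k σ))
  refine ⟨⟨val, fun k k' ρ σ => ?_⟩, fun k hk σ => ?_⟩
  · -- `ρ ≫ σ` is a degeneracy of its nondegenerate part, which is a face `τ` of that of `σ`.
    let τ := γ k' (ρ ≫ σ) ≫ ρ ≫ ε k σ
    have hτ : τ ≫ δ k σ = δ k' (ρ ≫ σ) := by
      have := γ k' (ρ ≫ σ) ≫= hεδ k' (ρ ≫ σ)
      rw [Category.assoc, Category.assoc, hεδ, ← this, reassoc_of% hγ]
    have hρ : ε k' (ρ ≫ σ) ≫ τ = ρ ≫ ε k σ := by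
      have := hδ k σ
      rw [← cancel_mono (δ k σ), Category.assoc, hτ, hεδ, Category.assoc, hεδ]
    refine (hval k σ).of_comp (hγ k σ) ?_
    rw [← hρ]
    exact (hτ ▸ hy (hm k σ) (hm k' (ρ ≫ σ)) τ (δ k σ)).comp (hval k' (ρ ≫ σ))
  · exact (hval k σ).eq (hγ k σ) (by simpa only [hεδ] using hy (hm k σ) hk (ε k σ) (δ k σ))

end Degeneracies

end PartialSimplex

lemma exists_mono_factors_iff {C : Type u} [Category.{v} C] [HasFiniteLimits C] {J : Type w}
    [Finite J] {S : C} {Z : J → C} (a b : ∀ j, S ⟶ Z j) :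
    ∃ (P : C) (p : P ⟶ S), Mono p ∧
      ∀ ⦃T : C⦄ (t : T ⟶ S), (∃ s, s ≫ p = t) ↔ ∀ j, t ≫ a j = t ≫ b j := by
  refine ⟨equalizer (Pi.lift a) (Pi.lift b), equalizer.ι _ _, inferInstance, fun T t => ?_⟩
  have : t ≫ Pi.lift a = t ≫ Pi.lift b ↔ ∀ j, t ≫ a j = t ≫ b j := by
    simp only [Pi.hom_ext_iff, Category.assoc, limit.lift_π, Fan.mk_pt, Fan.mk_π_app]
  rw [← this]
  refine ⟨?_, fun h => ⟨equalizer.lift t h, equalizer.lift_ι t h⟩⟩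
  rintro ⟨s, rfl⟩
  rw [Category.assoc, Category.assoc, equalizer.condition]

lemma PartialSimplex.exists_universal [HasFiniteLimits E] [∀ n, Mono (i.app n)]
    (hi : ∀ n, HasPartialClassifiers (i.app n)) (n : SimplexCategory) :
    ∃ (P : E) (U : PartialSimplex Y n P), ∀ ⦃T : E⦄ (F : PartialSimplex Y n T),
      ∃! t : T ⟶ P, U.precomp t = F := by
  let Y' (s : Σ k : Fin (n.len + 1), (⦋k⦌ ⟶ n)) : E := (Y ⦋s.1⦌).obj
  let π {k : Fin (n.len + 1)} (σ : ⦋k⦌ ⟶ n) : ∏ᶜ Y' ⟶ (Y ⦋k⦌).obj := Pi.π Y' ⟨k, σ⟩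
  choose Z a b hab using fun s : Σ k k' : Fin (n.len + 1), (⦋k'⦌ ⟶ ⦋k⦌) × (⦋k⦌ ⟶ n) =>
    IsRestriction.exists_eq_iff (hi _) s.2.2.1 (π s.2.2.2) (π (s.2.2.1 ≫ s.2.2.2))
  obtain ⟨P, p, hp, hpab⟩ := exists_mono_factors_iff a b
  obtain ⟨U, hU⟩ := exists_of_le (Y := Y) (n := n) (T := P)
    (fun k hk σ => p ≫ π (k := ⟨k.len, Nat.lt_succ_of_le hk⟩) σ)
    fun k k' hk hk' ρ σ => (hab ⟨⟨k.len, Nat.lt_succ_of_le hk⟩, ⟨k'.len, Nat.lt_succ_of_le hk'⟩,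
      ρ, σ⟩ p).1 ((hpab p).1 ⟨𝟙 P, Category.id_comp p⟩ _)
  refine ⟨P, U, fun T F => ?_⟩
  have hF (t : T ⟶ P) : U.precomp t = F ↔ t ≫ p = Pi.lift fun s => F.val s.2 := by
    refine ⟨fun h => Pi.hom_ext _ _ fun s => ?_, fun h => ext_of_le fun k hk σ => ?_⟩
    · rw [limit.lift_π, Category.assoc, ← h]
      exact congr_arg (t ≫ ·) (hU (Nat.le_of_lt_succ s.1.2) s.2).symm
    · rw [precomp_val, hU hk, reassoc_of% h]
      exact limit.lift_π _ _
  obtain ⟨t, ht⟩ := (hpab (Pi.lift fun s => F.val s.2)).2 fun s => (hab s _).2 (by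
    simpa [π] using F.isRestriction s.2.2.1 s.2.2.2)
  exact ⟨t, (hF t).2 ht, fun t' ht' => by rw [← cancel_mono p, ht, (hF t').1 ht']⟩

end PartialSimplices

section SimplicialPushforward

variable {E : Type u} [Category.{v} E] {A B X : SimplicialObject E} {i : A ⟶ B} {q : X ⟶ A}
  {Y : ∀ k : SimplexCategory, PartialClassifier (i.app (op k)) (q.app (op k))}

variable (Y) in
/-- The simplicial object of partial simplices: the pushforward of `q` along `i`, in terms of the
partial lift `ev` belonging to the top-dimensional simplex of `Δ[k]`. -/
structure SimplicialPushforward where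
  /-- The underlying simplicial object. -/
  obj : SimplicialObject E
  /-- The partial lift of the simplex of `B` underlying a partial simplex. -/
  ev : ∀ k : SimplexCategory, obj.obj (op k) ⟶ (Y k).obj
  isRestriction : ∀ ⦃k k' : SimplexCategory⦄ (ρ : k' ⟶ k),
    IsRestriction ρ (ev k) (obj.map ρ.op ≫ ev k')
  existsUnique : ∀ ⦃n : SimplexCategory⦄ ⦃T : E⦄ (F : PartialSimplex Y n T),
    ∃! t : T ⟶ obj.obj (op n), ∀ ⦃k : SimplexCategory⦄ (σ : k ⟶ n),
      t ≫ obj.map σ.op ≫ ev k = F.val σ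

lemma nonempty_simplicialPushforward [HasFiniteLimits E] [∀ n, Mono (i.app n)]
    (hi : ∀ n, HasPartialClassifiers (i.app n)) : Nonempty (SimplicialPushforward Y) := by
  choose P U hU using fun n => PartialSimplex.exists_universal (Y := Y) hi n
  have hext {n : SimplexCategory} {T : E} {t t' : T ⟶ P n}
      (h : (U n).precomp t = (U n).precomp t') : t = t' :=
    (hU n ((U n).precomp t)).unique rfl h.symm
  choose act hact _ using fun (n n' : SimplexCategory) (τ : n' ⟶ n) => hU n' ((U n).map τ)
  have hval {n n' k : SimplexCategory} (τ : n' ⟶ n) (σ : k ⟶ n') :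
      act n n' τ ≫ (U n').val σ = (U n).val (σ ≫ τ) := by
    rw [← PartialSimplex.precomp_val, hact, PartialSimplex.map_val]
  have hev {n k : SimplexCategory} (σ : k ⟶ n) : act n k σ ≫ (U k).val (𝟙 k) = (U n).val σ := by
    rw [hval, Category.id_comp]
  refine ⟨{
    obj := {
      obj n := P n.unop
      map τ := act _ _ τ.unop
      map_id n := hext (by ext; simp [hval])
      map_comp τ τ' := hext (by ext; simp [hval]) }
    ev k := (U k).val (𝟙 k)
    isRestriction k k' ρ := ?_
    existsUnique n T F := ?_ }⟩
  · simpa [hval] using (U k).isRestriction ρ (𝟙 k)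
  · simpa [hev, PartialSimplex.ext_iff, funext_iff] using hU n F

namespace SimplicialPushforward

variable (P : SimplicialPushforward Y) {T : SimplicialObject E}

/-- The simplices of `B` underlying partial simplices. -/
@[simps]
def proj : P.obj ⟶ B where
  app k := P.ev k.unop ≫ (Y k.unop).proj
  naturality k k' ρ := by simpa using (P.isRestriction ρ.unop).proj

/-- The partial simplex which corresponds to a simplex of the pushforward. -/
@[simps]
def partialSimplex {n : SimplexCategory} {T : E} (y : T ⟶ P.obj.obj (op n)) :
    PartialSimplex Y n T where
  val k σ := y ≫ P.obj.map σ.op ≫ P.ev k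
  isRestriction k k' ρ σ := by simpa using (P.isRestriction ρ).precomp (y ≫ P.obj.map σ.op)

lemma partialSimplex_injective {n : SimplexCategory} {T : E} :
    Function.Injective fun y : T ⟶ P.obj.obj (op n) => P.partialSimplex y := fun y _ h =>
  (P.existsUnique (P.partialSimplex y)).unique (fun _ _ => rfl) fun _ σ =>
    congr_arg (fun F : PartialSimplex Y n T => F.val σ) h.symm

lemma hom_ext_app {n : SimplexCategory} {T : E} {t t' : T ⟶ P.obj.obj (op n)}
    (h : ∀ ⦃k : SimplexCategory⦄ (σ : k ⟶ n),
      t ≫ P.obj.map σ.op ≫ P.ev k = t' ≫ P.obj.map σ.op ≫ P.ev k) : t = t' :=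
  P.partialSimplex_injective (PartialSimplex.ext (by ext k σ; exact h σ))

lemma hom_ext {f g : T ⟶ P.obj} (h : ∀ k, f.app (op k) ≫ P.ev k = g.app (op k) ≫ P.ev k) :
    f = g := by
  ext k
  refine P.hom_ext_app fun k' σ => ?_
  rw [← f.naturality_assoc, ← g.naturality_assoc, h]

lemma exists_hom (y : ∀ k : SimplexCategory, T.obj (op k) ⟶ (Y k).obj)
    (hy : ∀ ⦃k k' : SimplexCategory⦄ (ρ : k' ⟶ k), IsRestriction ρ (y k) (T.map ρ.op ≫ y k')) :
    ∃ f : T ⟶ P.obj, ∀ k, f.app (op k) ≫ P.ev k = y k := by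
  let F (n : SimplexCategory) : PartialSimplex Y n (T.obj (op n)) :=
    ⟨fun k σ => T.map σ.op ≫ y k, fun k k' ρ σ => by simpa using (hy ρ).precomp (T.map σ.op)⟩
  choose f hf using fun n => (P.existsUnique (F n)).exists
  refine ⟨⟨fun n => f n.unop, fun n n' τ => P.hom_ext_app fun k σ => ?_⟩, fun k => ?_⟩
  · have h : f n.unop ≫ P.obj.map (σ ≫ τ.unop).op ≫ P.ev k =
        T.map (σ ≫ τ.unop).op ≫ y k := hf _ _
    have h' : f n'.unop ≫ P.obj.map σ.op ≫ P.ev k = T.map σ.op ≫ y k := hf _ _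
    simpa [h'] using h.symm
  · simpa [F] using hf k (𝟙 k)

section

variable [∀ n, Mono (i.app n)]

lemma exists_ι : ∃ ι : X ⟶ P.obj, ∀ k, ι.app (op k) ≫ P.ev k = (Y k).ι :=
  P.exists_hom _ fun k k' ρ => by simpa using IsRestriction.of_total (𝟙 (X.obj (op k))) ρ

/-- The inclusion of the simplices of `X` as the total ones among the partial simplices. -/
def ι : X ⟶ P.obj := P.exists_ι.choose

lemma ι_app_ev (k : SimplexCategory) : P.ι.app (op k) ≫ P.ev k = (Y k).ι :=
  P.exists_ι.choose_spec k

lemma isPullback : IsPullback P.ι q P.proj i := by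
  refine .of_forall_isPullback_app fun ⟨k⟩ => ?_
  have : Mono (P.ι.app (op k)) := mono_of_mono_fac (P.ι_app_ev k)
  have w : P.ι.app (op k) ≫ P.proj.app (op k) = q.app (op k) ≫ i.app (op k) := by
    rw [proj_app, reassoc_of% P.ι_app_ev, (Y k).isPullback.w]
  choose x hx hxq using fun s : PullbackCone (P.proj.app (op k)) (i.app (op k)) =>
    (Y k).exists_lift (y := s.fst ≫ P.ev k) (by simpa using s.condition)
  have hxι (s : PullbackCone (P.proj.app (op k)) (i.app (op k))) :
      x s ≫ P.ι.app (op k) = s.fst := by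
    refine P.hom_ext_app fun k' σ => ?_
    rw [(P.isRestriction σ).map s.fst (x s) (hx s).symm, Category.assoc, ← P.ι.naturality_assoc,
      P.ι_app_ev]
  exact ⟨⟨w⟩, ⟨PullbackCone.IsLimit.mk _ x hxι hxq fun s m hm _ => by
    rw [← cancel_mono (P.ι.app (op k)), hm, hxι]⟩⟩

variable [HasPullbacks E]

lemma existsUnique_partialLift {K : SimplicialObject E} (t : T ⟶ B) (fst : K ⟶ T) (snd : K ⟶ A)
    (hK : IsPullback fst snd t i) (g : K ⟶ X) (hg : g ≫ q = snd) :
    ∃! f : T ⟶ P.obj, f ≫ P.proj = t ∧ fst ≫ f = g ≫ P.ι := by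
  choose y hy hyu using fun k => (Y k).existsUnique _ _ _ (hK.app (op k)) (g.app (op k))
    (NatTrans.congr_app hg (op k))
  obtain ⟨f, hf⟩ := P.exists_hom y fun k k' ρ => by
    refine ⟨by rw [Category.assoc, (hy k').1, t.naturality, reassoc_of% (hy k).1], ?_⟩
    intro T' u x hx
    obtain ⟨r, hr, -⟩ := (hK.app (op k)).exists_lift u (x ≫ q.app (op k)) (by
      simpa [(hy k).1, (Y k).isPullback.w] using hx =≫ (Y k).proj)
    have hrx : r ≫ g.app (op k) = x := by
      rw [← cancel_mono (Y k).ι, Category.assoc, ← (hy k).2, reassoc_of% hr, hx]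
    rw [← hr, Category.assoc, ← fst.naturality_assoc, (hy k').2, ← hrx, g.naturality_assoc,
      Category.assoc]
  refine ⟨f, ⟨?_, P.hom_ext fun k => ?_⟩, fun f' ⟨hf't, hf'⟩ => P.hom_ext fun k => ?_⟩
  · ext ⟨k⟩
    exact (reassoc_of% hf k) _ |>.trans (hy k).1
  · simp [hf, P.ι_app_ev, (hy k).2]
  · rw [hf]
    refine hyu k _ ⟨?_, ?_⟩
    · simpa using NatTrans.congr_app hf't (op k)
    · simpa [P.ι_app_ev] using NatTrans.congr_app hf' (op k) =≫ P.ev k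

/-- The simplicial object of partial simplices is the pushforward of `q` along `i`. -/
def partialClassifier : PartialClassifier i q :=
  ⟨P.obj, P.proj, P.ι, P.isPullback, fun _ _ t fst snd hK g hg =>
    P.existsUnique_partialLift t fst snd hK g hg⟩

end

end SimplicialPushforward

end SimplicialPushforward

section StableFaces

variable {k m n : SimplexCategory}

lemma exists_mono_range_eq {s : Set (Fin (n.len + 1))} (hs : s.Nonempty) :
    ∃ (k : SimplexCategory) (δ : k ⟶ n), Mono δ ∧ Set.range δ.toOrderHom = s := by
  classical
  have hcard : s.toFinset.card = s.toFinset.card - 1 + 1 :=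
    (Nat.succ_pred_eq_of_pos (Finset.card_pos.2 (Set.toFinset_nonempty.2 hs))).symm
  refine ⟨⦋s.toFinset.card - 1⦌,
    SimplexCategory.Hom.mk (s.toFinset.orderEmbOfFin hcard).toOrderHom,
    SimplexCategory.mono_iff_injective.2 (s.toFinset.orderEmbOfFin hcard).injective, ?_⟩
  exact (Finset.range_orderEmbOfFin _ hcard).trans s.coe_toFinset

lemma exists_lift_of_range_subset (δ : k ⟶ n) [Mono δ] {τ : m ⟶ n}
    (h : Set.range τ.toOrderHom ⊆ Set.range δ.toOrderHom) : ∃ τ' : m ⟶ k, τ' ≫ δ = τ := by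
  have hδ : StrictMono δ.toOrderHom :=
    δ.toOrderHom.monotone.strictMono_of_injective (SimplexCategory.mono_iff_injective.1 ‹_›)
  choose f hf using fun x => h (Set.mem_range_self x)
  refine ⟨SimplexCategory.Hom.mk ⟨f, fun x y hxy => ?_⟩, ?_⟩
  · rw [← hδ.le_iff_le, hf, hf]
    exact τ.toOrderHom.monotone hxy
  · ext x : 3
    exact hf x

/-- The vertices of the stable face `δ` are those whose image under `e` is a vertex of `σ ≫ e`. -/
lemma exists_stable_face {e : n ⟶ n} (he : e ≫ e = e) (σ : m ⟶ n) :
    ∃ (k : SimplexCategory) (δ : k ⟶ n) (e' : k ⟶ k) (σ' : m ⟶ k) (κ : k ⟶ m), Mono δ ∧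
      e' ≫ e' = e' ∧ e' ≫ δ = δ ≫ e ∧ σ' ≫ δ = σ ∧ κ ≫ σ ≫ e = δ ≫ e := by
  obtain ⟨p, ε, η, γ, hεη, hγ, hη, -⟩ := exists_splitEpi_mono (σ ≫ e)
  have happ {k : SimplexCategory} {f g : k ⟶ n} (h : f = g) (x : Fin (k.len + 1)) :
      f.toOrderHom x = g.toOrderHom x := by rw [h]
  have hσ (x) : σ.toOrderHom x ∈ e.toOrderHom ⁻¹' Set.range η.toOrderHom :=
    ⟨ε.toOrderHom x, happ hεη x⟩
  obtain ⟨k, δ, hδ, hδe⟩ := exists_mono_range_eq ⟨_, hσ 0⟩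
  have hδx (x) : δ.toOrderHom x ∈ e.toOrderHom ⁻¹' Set.range η.toOrderHom :=
    hδe.subset (Set.mem_range_self x)
  obtain ⟨σ', hσ'⟩ := exists_lift_of_range_subset δ (τ := σ) (by
    rw [hδe]
    exact Set.range_subset_iff.2 hσ)
  obtain ⟨π, hπ⟩ := exists_lift_of_range_subset η (τ := δ ≫ e) (Set.range_subset_iff.2 hδx)
  obtain ⟨e', he'⟩ := exists_lift_of_range_subset δ (τ := δ ≫ e) (by
    rw [hδe]
    refine Set.range_subset_iff.2 fun x => ?_
    obtain ⟨z, hz⟩ := hδx x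
    exact ⟨z, hz.trans (happ he _).symm⟩)
  refine ⟨k, δ, e', σ', π ≫ γ, hδ, ?_, he', hσ', ?_⟩
  · rw [← cancel_mono δ, Category.assoc, he', reassoc_of% he', he]
  · rw [← hεη, Category.assoc, reassoc_of% hγ, hπ]

end StableFaces

section ForallSieve

variable {E : Type u} [Category.{v} E] {V W : E}

/-- The universal quantification of a sieve `S` along `ι`: the morphisms all of whose restrictions
which factor through `ι` do so through `S`. -/
def forallSieve (ι : W ⟶ V) (S : Sieve W) : Sieve V where
  arrows T y := ∀ ⦃T' : E⦄ (u : T' ⟶ T) (x : T' ⟶ W), u ≫ y = x ≫ ι → S x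
  downward_closed h u _ u' x hx := h (u' ≫ u) x (by rwa [Category.assoc])

lemma IsDecidable.forallSieve [FinitaryPreExtensive E] {ι : W ⟶ V} [Mono ι] {S : Sieve W}
    (hι : IsDecidable (factorSieve ι)) (hS : IsDecidable S)
    (hS' : ∀ ⦃T : E⦄ (x : T ⟶ W), Nonempty (IsInitial T) → S x) :
    IsDecidable (forallSieve ι S) := by
  refine of_cover hι ?_
  rintro T t (ht | ht)
  · obtain ⟨x, rfl⟩ := (factorSieve_apply _ _).1 ht
    have : (EnrichedLifting.forallSieve ι S).pullback (x ≫ ι) = S.pullback x := by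
      ext T' u
      refine ⟨fun h => h (𝟙 T') (u ≫ x) (by simp), fun h T'' u' x' hx' => ?_⟩
      simp only [← Category.assoc, cancel_mono] at hx'
      rw [← hx', Category.assoc]
      exact S.downward_closed h u'
    rw [this]
    exact hS.pullback x
  · exact of_id_mem fun T' u x hx =>
      hS' x (ht u ((factorSieve_apply _ _).2 ⟨x, by simpa using hx.symm⟩))

end ForallSieve

section CofibrantPushforward

variable {E : Type u} [Category.{v} E] {A B X : SimplicialObject E} {i : A ⟶ B} {q : X ⟶ A}
  {Y : ∀ k : SimplexCategory, PartialClassifier (i.app (op k)) (q.app (op k))}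

namespace PartialSimplex

variable {n : SimplexCategory} {T : E} (F : PartialSimplex Y n T)

lemma val_proj {k : SimplexCategory} (σ : k ⟶ n) :
    F.val σ ≫ (Y k).proj = (F.val (𝟙 n) ≫ (Y n).proj) ≫ B.map σ.op := by
  simpa using (F.isRestriction σ (𝟙 n)).proj

/-- An idempotent `e` acts on the partial lifts only over the faces `δ` of `Δ[n]` which are stable
under `e`, but every face lies on a stable one. -/
lemma map_eq_self_iff [HasPullbacks E] [∀ n, Mono (i.app n)] {e : n ⟶ n} (he : e ≫ e = e) :
    F.map e = F ↔ fixedSieve B e (F.val (𝟙 n) ≫ (Y n).proj) ∧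
      ∀ ⦃k : SimplexCategory⦄ (δ : k ⟶ n) (e' : k ⟶ k), Mono δ → e' ≫ e' = e' → e' ≫ δ = δ ≫ e →
        forallSieve (Y k).ι (fixedSieve X e') (F.val δ) := by
  constructor
  · intro h
    have hval {k : SimplexCategory} (σ : k ⟶ n) : F.val (σ ≫ e) = F.val σ := by
      rw [← map_val, h]
    refine ⟨?_, fun k δ e' _ _ hδ T' u x hx => ?_⟩
    · rw [fixedSieve_apply, ← val_proj, ← Category.id_comp e, hval]
    · rw [fixedSieve_apply, ← cancel_mono (Y k).ι, Category.assoc,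
        ← (F.isRestriction e' δ).map u x hx, hδ, hval, hx]
  · rintro ⟨hB, hX⟩
    have hproj {k : SimplexCategory} (σ : k ⟶ n) :
        F.val (σ ≫ e) ≫ (Y k).proj = F.val σ ≫ (Y k).proj := by
      rw [F.val_proj (σ ≫ e), F.val_proj σ, op_comp, B.map_comp,
        ← Category.assoc _ (B.map e.op), fixedSieve_apply.1 hB]
    ext m σ
    refine (Y m).hom_ext (hproj σ) fun T' u x hx => ?_
    obtain ⟨k, δ, e', σ', κ, hδ, he', heδ, rfl, hκ⟩ := exists_stable_face he σ
    have hκx : u ≫ F.val (δ ≫ e) = x ≫ X.map κ.op ≫ (Y k).ι := by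
      rw [← hκ]
      exact (F.isRestriction κ _).map u x hx
    obtain ⟨x', hx', -⟩ := (Y k).exists_lift (y := u ≫ F.val δ)
      (a := x ≫ X.map κ.op ≫ q.app (op k)) (by
        rw [Category.assoc, ← hproj, reassoc_of% hκx, (Y k).isPullback.w]
        simp only [Category.assoc])
    have hfix : x' ≫ X.map e'.op = x' := hX δ e' hδ he' heδ u x' hx'.symm
    have hσ' : u ≫ F.val (σ' ≫ δ) = x' ≫ X.map σ'.op ≫ (Y m).ι :=
      (F.isRestriction σ' δ).map u x' hx'.symm
    rw [hσ', ← hx, map_val, Category.assoc, ← heδ, ← Category.assoc σ',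
      (F.isRestriction (σ' ≫ e') δ).map u x' hx'.symm, op_comp, X.map_comp, Category.assoc,
      reassoc_of% hfix]

end PartialSimplex

namespace SimplicialPushforward

variable (P : SimplicialPushforward Y)

lemma fixedSieve_iff_map_eq {n : SimplexCategory} {e : n ⟶ n} {T : E} {y : T ⟶ P.obj.obj (op n)} :
    fixedSieve P.obj e y ↔ (P.partialSimplex y).map e = P.partialSimplex y := by
  rw [fixedSieve_apply, ← P.partialSimplex_injective.eq_iff, Eq.congr_left]
  ext k σ
  simp

end SimplicialPushforward

lemma Cofibrant.of_mono [HasFiniteLimits E] [HasCountableCoproducts E] [FinitaryExtensive E]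
    {Z Z' : SimplicialObject E} (hZ : Cofibrant Z) (φ : Z' ⟶ Z) [∀ n, Mono (φ.app n)] :
    Cofibrant Z' := by
  rw [cofibrant_iff_isDecidable_fixedSieve] at hZ ⊢
  intro m e he
  have : fixedSieve Z' e = (fixedSieve Z e).pullback (φ.app (op m)) := by
    ext T z
    simp only [Sieve.pullback_apply, fixedSieve_apply, Category.assoc, ← φ.naturality]
    rw [← Category.assoc, cancel_mono]
  rw [this]
  exact (hZ e he).pullback _

namespace SimplicialPushforward

variable (P : SimplicialPushforward Y)

lemma fixedSieve_eq [HasPullbacks E] [∀ n, Mono (i.app n)] {n : SimplexCategory} {e : n ⟶ n}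
    (he : e ≫ e = e) :
    fixedSieve P.obj e = (fixedSieve B e).pullback (P.proj.app (op n)) ⊓
      ⨅ (k : Fin (n.len + 1)) (δ : ⦋k⦌ ⟶ n) (e' : ⦋k⦌ ⟶ ⦋k⦌) (_ : Mono δ) (_ : e' ≫ e' = e')
        (_ : e' ≫ δ = δ ≫ e), (forallSieve (Y ⦋k⦌).ι (fixedSieve X e')).pullback
          (P.obj.map δ.op ≫ P.ev ⦋k⦌) := by
  ext T y
  rw [P.fixedSieve_iff_map_eq, PartialSimplex.map_eq_self_iff _ he]
  simp only [Sieve.inter_apply, iInf, Sieve.sInf_apply, Set.forall_mem_range, Sieve.pullback_apply,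
    P.partialSimplex_val, op_id, P.obj.map_id, Category.id_comp, Category.assoc, proj_app]
  refine and_congr_right fun _ => ⟨fun h k δ e' hδ he' heδ => h δ e' hδ he' heδ,
    fun h k δ e' hδ he' heδ => ?_⟩
  exact h ⟨k.len, Nat.lt_succ_of_le (SimplexCategory.len_le_of_mono δ)⟩ δ e' hδ he' heδ

theorem cofibrant [HasFiniteLimits E] [HasCountableCoproducts E] [FinitaryExtensive E]
    (hi : ∀ n, IsCoproductInclusion (i.app n)) (hB : Cofibrant B) (hX : Cofibrant X) :
    Cofibrant P.obj := by
  rw [cofibrant_iff_isDecidable_fixedSieve] at hB hX ⊢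
  intro n e he
  have hmono n : Mono (i.app n) := (hi n).mono
  rw [P.fixedSieve_eq he]
  refine ((hB e he).pullback _).inf <| .iInf fun k => .iInf fun δ => .iInf fun e' =>
    .iInf fun _ => .iInf fun he' => .iInf fun _ => .pullback (.forallSieve ?_ (hX e' he') ?_) _
  · rw [PartialClassifier.factorSieve_ι]
    exact (hi _).isDecidable_factorSieve.pullback _
  · exact fun T x ⟨hT⟩ => hT.hom_ext _ _

end SimplicialPushforward

end CofibrantPushforward

end

end EnrichedLifting

theorem mainTheorem11_general {E : Type u} [Category.{v} E] [HasFiniteLimits E]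
    [HasCountableCoproducts E] [FinitaryExtensive E] {A B : SimplicialObject E} (i : A ⟶ B)
    (hi : ∀ n, EnrichedLifting.IsCoproductInclusion (i.app n))
    (hB : EnrichedLifting.Cofibrant B) :
    EnrichedLifting.Exponentiable i ∧
      ∀ (pushforward : Over A ⥤ Over B), (Over.pullback i ⊣ pushforward) →
        ∀ X : Over A, EnrichedLifting.Cofibrant X.left →
          EnrichedLifting.Cofibrant (pushforward.obj X).left := by
  have hmono n : Mono (i.app n) := (hi n).mono
  have : Mono i := NatTrans.mono_of_mono_app i
  have hpush {X : SimplicialObject E} (q : X ⟶ A) :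
      ∃ Y, Nonempty (EnrichedLifting.SimplicialPushforward (i := i) (q := q) Y) :=
    ⟨fun k => ((hi (op k)).hasPartialClassifiers (q.app _)).some,
      EnrichedLifting.nonempty_simplicialPushforward fun n => (hi n).hasPartialClassifiers⟩
  refine ⟨EnrichedLifting.HasPartialClassifiers.exponentiable fun X q => ?_,
    fun pushforward adj X hX => ?_⟩
  · obtain ⟨Y, ⟨P⟩⟩ := hpush q
    exact ⟨P.partialClassifier⟩
  · obtain ⟨Y, ⟨P⟩⟩ := hpush X.hom
    obtain ⟨φ⟩ : Nonempty ((pushforward.obj X).left ≅ P.obj) :=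
      P.partialClassifier.nonempty_iso_rightAdjoint_obj adj
    exact (P.cofibrant hi hB hX).of_mono φ.hom

theorem mainTheorem11 {E : Type u} [Category.{v} E] [CountablyLextensive E]
    {A B : SimplicialObject E} (i : A ⟶ B) (hA : EnrichedLifting.Cofibrant A)
    (hB : EnrichedLifting.Cofibrant B) (hi : EnrichedLifting.Cofibration i) :
    EnrichedLifting.Exponentiable i ∧
      ∀ (pushforward : Over A ⥤ Over B), (Over.pullback i ⊣ pushforward) →
        ∀ X : Over A, EnrichedLifting.Cofibrant X.left →
          EnrichedLifting.Cofibrant (pushforward.obj X).left :=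
  mainTheorem11_general i hi.isCoproductInclusion_app hB
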